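/- Let $N\ge 1$, $\Sigma=\{1,\dots,N\}$, $A_\sigma\in\mathbb R^{n\times n}$, $B_\sigma\in\mathbb R^{n\times m}$ with every pair $(A_\sigma,B_\sigma)$ controllable (Kalman rank condition). Consider $\dot x(t)=A_{\sigma(t)}x(t)+B_{\sigma(t)}u(t)$, where the switching signal $\sigma:[0,\infty)\to\Sigma$ is an arbitrary piecewise continuous (hence piecewise constant) function. Let $G_0\in\mathbb R^{n\times n}$ and $Y_{0,\sigma}\in\mathbb R^{m\times n}$ be any solution of $$A_\sigma G_0-G_0A_\sigma+B_\sigma Y_{0,\sigma}=A_\sigma,\qquad G_0B_\sigma=0,\qquad \sigma\in\Sigma .$$ **1.** There is $\varepsilon>0$ such that $I_n+\mu G_0$ is anti-Hurwitz (all eigenvalues have positive real part) for $|\mu|<\varepsilon$. The matrix $G_0-I_n$ is invertible. With $K_{0,\sigma}=Y_{0,\sigma}(G_0-I_n)^{-1}$, $A_{0,\sigma}=A_\sigma+B_\sigma K_{0,\sigma}$ and $G_d=I_n+\mu G_0$ one has, for all $\mu\in\mathbb R$ and $\sigma\in\Sigma$, $$A_{0,\sigma}G_d=(G_d+\mu I_n)A_{0,\sigma},\qquad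 G_dB_\sigma=B_\sigma .$$ **2.** Let moreover $\mu\in\mathbb R$, $\rho>0$, and let $X\in\mathbb R^{n\times n}$ symmetric and $Y_\sigma\in\mathbb R^{m\times n}$ satisfy $$XA_{0,\sigma}^\top+A_{0,\sigma}X+B_\sigma Y_\sigma+Y_\sigma^\top B_\sigma^\top+\rho(G_dX+XG_d^\top)\preceq0\ \ (\sigma\in\Sigma),\qquad G_dX+XG_d^\top\succ0,\qquad X\succ0 .$$ Put $P=X^{-1}$, $K_\sigma=Y_\sigma X^{-1}$, $d(s)=e^{sG_d}$. Then $d$ is a linear dilation: it is a continuous one-parameter group with $\|d(s)x\|\to0$ as $s\to-\infty$ and $\|d(s)x\|\to\infty$ as $s\to+\infty$ for $\|x\|=1$. For each $x\neq0$ there is exactly one $s_x\in\mathbb R$ with $\sqrt{(d(-s_x)x)^\top P\,d(-s_x)x}=1$; the canonical homogeneous norm is $\|x\|_d=e^{s_x}$, $\|0\|_d=0$. Consider the feedback $$u_\sigma(x)=K_{0,\sigma}x+\|x\|_d^{1+\mu}K_\sigma\, d(-\ln\|x\|_d)x\quad(x\ne0),\qquad u_\sigma(0)=0,$$ the closed-loop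 fields $f_\sigma(x)=A_\sigma x+B_\sigma u_\sigma(x)$, and the closed loop $\dot x=f_{\sigma(t)}(x)$, $x(t_0)=x_0$, $t_0\ge0$, whose solutions are understood in the sense of Filippov. Then: * $\|\cdot\|_d$ is a common Lyapunov function of the closed loop: it is continuous, positive definite, radially unbounded, $C^1$ on $\mathbb R^n\setminus\{0\}$ and strictly decreasing along all modes. Moreover $\frac{d}{dt}\|x\|_d\le-\rho\|x\|_d^{1+\mu}$ for $x\neq0$, that is, $D\|\cdot\|_d(x)\,f_\sigma(x)\le-\rho\|x\|_d^{1+\mu}$ for all $\sigma\in\Sigma$ and $x\ne0$, and along every solution the inequality holds at almost every $t\ge t_0$ with $x(t)\neq0$. * For all $\sigma$ and $x\neq0$, $|u_\sigma(x)|\le|K_{0,\sigma}x|+\tilde k_\sigma\|x\|_d^{1+\mu}$ with $\tilde k_\sigma=\sqrt{\lambda_{\max}(X^{1/2}K_\sigma^\top K_\sigma X^{1/2})}$. * The closed loop is $d$-homogeneous of degree $\mu$: $f_\sigma(d(s)x)=e^{\mu s}d(s)f_\sigma(x)$ for all $s\in\mathbb R$, $x\in\mathbb R^n$, $\sigma\in\Sigma$;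 and, for $t_0=0$, if $x(\cdot)$ is a solution under $\sigma(\cdot)$, then $t\mapsto d(s)x(e^{\mu s}t)$ is a solution, and the only one starting at $d(s)x(0)$, under the signal $t\mapsto\sigma(e^{\mu s}t)$. * For $\mu\ge-1$, each initial condition and each switching signal give exactly one solution on $[t_0,\infty)$. Under arbitrary switching, and uniformly in the switching signal and in $t_0$, the origin of the closed loop is * globally uniformly finite-time stable if $\mu\in[-1,0)$, with $x(t)=0$ for all $t\ge t_0+\dfrac{\|x_0\|_d^{-\mu}}{-\mu\rho}$; * globally uniformly exponentially stable if $\mu=0$, with $\|x(t)\|_d\le e^{-\rho(t-t_0)}\|x_0\|_d$ for all $t\ge t_0$; * globally uniformly nearly fixed-time stable if $\mu>0$: for every $r>0$, $\|x(t)\|_d\le r$ for all $t\ge t_0+\dfrac1{\mu\rho\, r^{\mu}}$, independently of $x_0$. Here global uniform finite-time stability means global uniform asymptotic stability (uniform Lyapunov stability, uniform boundedness of solutions and uniform attractivity) together with a settling time that is bounded on bounded sets of initial states; global uniform nearly fixed-time stability means global uniform asymptotic stability together with, for every $r>0$, a time $T_r$ such that $\|x(t)\|\le r$ for all $t\ge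 t_0+T_r$ and all $x_0$. -/

import Mathlib

open Matrix MeasureTheory Filter Topology

namespace SwitchedHom

noncomputable section

/-- State and input spaces with their Euclidean norms. -/
abbrev Vec (n : ℕ) := EuclideanSpace ℝ (Fin n)

abbrev Mat (k l : ℕ) := Matrix (Fin k) (Fin l) ℝ

/-! ### Matrices -/

/-- All complex eigenvalues of the real matrix `G` have positive real part. -/
def AntiHurwitz {n : ℕ} (G : Mat n n) : Prop :=
  ∀ z ∈ spectrum ℂ (G.map (algebraMap ℝ ℂ)), 0 < z.re

/-- The `n × (n m)` matrix `[B, A B, …, A ^ (n - 1) B]`. -/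
def controllabilityMatrix {n m : ℕ} (A : Mat n n) (B : Mat n m) :
    Matrix (Fin n) (Fin n × Fin m) ℝ :=
  Matrix.of fun i kj => (A ^ (kj.1 : ℕ) * B) i kj.2

def Controllable {n m : ℕ} (A : Mat n n) (B : Mat n m) : Prop :=
  (controllabilityMatrix A B).rank = n

/-- Largest real eigenvalue (used for symmetric matrices only). -/
def lambdaMax {n : ℕ} (M : Mat n n) : ℝ := sSup (spectrum ℝ M)

open scoped MatrixOrder in
/-- `√ λ_max (X^{1/2} Kᵀ K X^{1/2})`, where `X^{1/2}` is the positive semidefinite square root. -/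
def gainBound {n m : ℕ} (X : Mat n n) (K : Mat m n) : ℝ :=
  Real.sqrt (lambdaMax (CFC.sqrt X * Kᵀ * K * CFC.sqrt X))

/-! ### Dilations and the canonical homogeneous norm -/

/-- `d(s) = exp (s G)`. -/
def dil {n : ℕ} (G : Mat n n) (s : ℝ) : Mat n n := NormedSpace.exp (s • G)

/-- `d` is a linear continuous dilation of `ℝⁿ`. -/
structure IsLinearDilation {n : ℕ} (d : ℝ → Mat n n) : Prop where
  zero : d 0 = 1
  add : ∀ t s, d (t + s) = d t * d s
  cont : Continuous d
  atBot : ∀ x : Vec n, ‖x‖ = 1 → Tendsto (fun s => ‖toEuclideanLin (d s) x‖) atBot (𝓝 0)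
  atTop : ∀ x : Vec n, ‖x‖ = 1 → Tendsto (fun s => ‖toEuclideanLin (d s) x‖) atTop atTop

/-- The weighted Euclidean norm `√(xᵀ P x)`. -/
def wnorm {n : ℕ} (P : Mat n n) (x : Vec n) : ℝ := Real.sqrt (x.ofLp ⬝ᵥ (P *ᵥ x.ofLp))

open Classical in
/-- The canonical homogeneous norm induced by `√(xᵀ P x)` and the dilation `d(s) = exp (s G)`:
`‖x‖_d = e ^ s` with `‖d(-s) x‖_P = 1` for `x ≠ 0`, and `‖0‖_d = 0` (there is no such `s` for
`x = 0`). -/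
def homNorm {n : ℕ} (G P : Mat n n) (x : Vec n) : ℝ :=
  if h : ∃ s : ℝ, wnorm P (toEuclideanLin (dil G (-s)) x) = 1 then Real.exp h.choose else 0

/-! ### The closed loop -/

/-- `u = K₀ x + ‖x‖_d ^ (1 + μ) K d(-ln ‖x‖_d) x`; this is `0` at `x = 0`. -/
def feedback {n m : ℕ} (G P : Mat n n) (μ : ℝ) (K₀ K : Mat m n) (x : Vec n) : Vec m :=
  toEuclideanLin K₀ x + (homNorm G P x ^ (1 + μ)) •
    toEuclideanLin K (toEuclideanLin (dil G (-Real.log (homNorm G P x))) x)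

/-- The right-hand side `A x + B u` of one mode under the state feedback `u`. -/
def modeField {n m : ℕ} (A : Mat n n) (B : Mat n m) (u : Vec n → Vec m) (x : Vec n) : Vec n :=
  toEuclideanLin A x + toEuclideanLin B (u x)

/-! ### Switched systems and their solutions -/

/-- Piecewise continuous switching signals on `[0, ∞)` with values in the discrete set `Fin N`. -/
def IsSwitchingSignal {N : ℕ} (σ : ℝ → Fin N) : Prop :=
  ∀ T : ℝ, {t : ℝ | 0 ≤ t ∧ t ≤ T ∧ ¬ ContinuousAt σ t}.Finite

/-- The Filippov regularization of a vector field: the intersection over `δ > 0` and over null sets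
`S` of the closed convex hulls of `g (B(x, δ) \ S)`. -/
def filippov {n : ℕ} (g : Vec n → Vec n) (x : Vec n) : Set (Vec n) :=
  ⋂ (δ : ℝ) (_ : 0 < δ) (S : Set (Vec n)) (_ : volume S = 0),
    closure (convexHull ℝ (g '' (Metric.ball x δ \ S)))

/-- `x` is a Filippov solution on `[t₀, ∞)` of `ẋ = f_{σ(t)}(x)`. -/
structure IsSolution {n N : ℕ} (f : Fin N → Vec n → Vec n) (σ : ℝ → Fin N) (t₀ : ℝ)
    (x : ℝ → Vec n) : Prop where
  absCont : ∀ T, t₀ ≤ T → AbsolutelyContinuousOnInterval x t₀ T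
  inclusion : ∀ᵐ t ∂(volume.restrict (Set.Ici t₀)), ∃ v ∈ filippov (f (σ t)) (x t), HasDerivAt x v t

/-- Forward existence and uniqueness of solutions under every switching signal. -/
def ForwardComplete {n N : ℕ} (f : Fin N → Vec n → Vec n) : Prop :=
  ∀ σ : ℝ → Fin N, IsSwitchingSignal σ → ∀ t₀ : ℝ, 0 ≤ t₀ → ∀ x₀ : Vec n,
    (∃ x, IsSolution f σ t₀ x ∧ x t₀ = x₀) ∧
    ∀ x y, IsSolution f σ t₀ x → IsSolution f σ t₀ y → x t₀ = x₀ → y t₀ = x₀ →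
      ∀ t, t₀ ≤ t → x t = y t

/-- A vector field is homogeneous of degree `μ` with respect to `d`. -/
def IsHomogeneousField {n : ℕ} (d : ℝ → Mat n n) (μ : ℝ) (g : Vec n → Vec n) : Prop :=
  ∀ (s : ℝ) (x : Vec n),
    g (toEuclideanLin (d s) x) = Real.exp (μ * s) • toEuclideanLin (d s) (g x)

/-- The switched system is homogeneous of degree `μ`: for every solution `x` under `σ`, the curve
`t ↦ d(s) x(e^{μ s} t)` is a solution under `σ_s(t) = σ(e^{μ s} t)`, and it is the only one that
starts at `d(s) x(0)`, that is, `x(t, d(s) x₀, σ_s) = d(s) x(e^{μ s} t, x₀, σ)` for `t ≥ 0`. -/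
def IsHomogeneousSwitched {n N : ℕ} (d : ℝ → Mat n n) (μ : ℝ) (f : Fin N → Vec n → Vec n) :
    Prop :=
  ∀ (s : ℝ) (σ : ℝ → Fin N), IsSwitchingSignal σ → ∀ x : ℝ → Vec n, IsSolution f σ 0 x →
    IsSolution f (fun t => σ (Real.exp (μ * s) * t)) 0
      (fun t => toEuclideanLin (d s) (x (Real.exp (μ * s) * t))) ∧
    ∀ y : ℝ → Vec n, IsSolution f (fun t => σ (Real.exp (μ * s) * t)) 0 y →
      y 0 = toEuclideanLin (d s) (x 0) →
      ∀ t, 0 ≤ t → y t = toEuclideanLin (d s) (x (Real.exp (μ * s) * t))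

/-! ### Lyapunov functions and stability under arbitrary switching

All constants below are uniform in the switching signal and in the initial time. -/

/-- `V` is a common Lyapunov function for all modes: continuous, positive definite, radially
unbounded, continuously differentiable off the origin, and strictly decreasing along each mode. -/
structure IsCommonLyapunov {n N : ℕ} (f : Fin N → Vec n → Vec n) (V : Vec n → ℝ) : Prop where
  cont : Continuous V
  zero : V 0 = 0
  pos : ∀ x, x ≠ 0 → 0 < V x
  radial : Tendsto V (cocompact (Vec n)) atTop
  smooth : ContDiffOn ℝ 1 V {0}ᶜ
  decay : ∀ i x, x ≠ 0 → fderiv ℝ V x (f i x) < 0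

/-- Global uniform asymptotic stability of the origin. -/
structure GUAS {n N : ℕ} (f : Fin N → Vec n → Vec n) : Prop where
  stable : ∀ ε > 0, ∃ δ > 0, ∀ σ, IsSwitchingSignal σ → ∀ t₀, 0 ≤ t₀ → ∀ x, IsSolution f σ t₀ x →
    ‖x t₀‖ ≤ δ → ∀ t, t₀ ≤ t → ‖x t‖ ≤ ε
  bounded : ∀ R > 0, ∃ M > 0, ∀ σ, IsSwitchingSignal σ → ∀ t₀, 0 ≤ t₀ → ∀ x, IsSolution f σ t₀ x →
    ‖x t₀‖ ≤ R → ∀ t, t₀ ≤ t → ‖x t‖ ≤ M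
  attractive : ∀ R > 0, ∀ ε > 0, ∃ T > 0, ∀ σ, IsSwitchingSignal σ → ∀ t₀, 0 ≤ t₀ →
    ∀ x, IsSolution f σ t₀ x → ‖x t₀‖ ≤ R → ∀ t, t₀ + T ≤ t → ‖x t‖ ≤ ε

/-- Global uniform finite-time stability; the settling time is bounded on bounded sets of initial
states. -/
structure UniformlyFiniteTimeStable {n N : ℕ} (f : Fin N → Vec n → Vec n) : Prop where
  guas : GUAS f
  settling : ∀ R > 0, ∃ T > 0, ∀ σ, IsSwitchingSignal σ → ∀ t₀, 0 ≤ t₀ → ∀ x, IsSolution f σ t₀ x →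
    ‖x t₀‖ ≤ R → ∀ t, t₀ + T ≤ t → x t = 0

/-- Global uniform exponential stability. -/
def UniformlyExponentiallyStable {n N : ℕ} (f : Fin N → Vec n → Vec n) : Prop :=
  ∃ C > 0, ∃ a > 0, ∀ σ, IsSwitchingSignal σ → ∀ t₀, 0 ≤ t₀ → ∀ x, IsSolution f σ t₀ x →
    ∀ t, t₀ ≤ t → ‖x t‖ ≤ C * Real.exp (-a * (t - t₀)) * ‖x t₀‖

/-- Global uniform nearly fixed-time stability: every ball is reached, for good, after a time that
does not depend on the initial state. -/
structure UniformlyNearlyFixedTimeStable {n N : ℕ} (f : Fin N → Vec n → Vec n) : Prop where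
  guas : GUAS f
  settling : ∀ r > 0, ∃ T > 0, ∀ σ, IsSwitchingSignal σ → ∀ t₀, 0 ≤ t₀ → ∀ x, IsSolution f σ t₀ x →
    ∀ t, t₀ + T ≤ t → ‖x t‖ ≤ r

end

end SwitchedHom

open SwitchedHom

/-!
The theorem splits into algebra, geometry and differential equations.

*Algebra.* A left eigenvector `w` of `G₀` for the eigenvalue `1` would satisfy
`wᵀ Aᵏ G₀ = (k + 1) wᵀ Aᵏ`, so that `G₀ B = 0` forces `wᵀ Aᵏ B = 0` for all `k`, which controllability
excludes (`isUnit_sub_one`). The relations `A₀ G = (G + μ) A₀` and `G B = B` are then direct, and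
exponentiating them gives `d(s) A₀ = e^{-μ s} A₀ d(s)` and `d(s) B = e^s B` (`dil_intertwine`).

*Geometry.* With `P = X⁻¹`, the condition `G X + X Gᵀ ≻ 0` becomes `P G + Gᵀ P ≻ 0`, so
`s ↦ ‖d(s) x‖_P` grows exponentially. This makes `d` a dilation, defines `V = ‖·‖_d`, and makes `V` a
`C¹` function off the origin by the implicit function theorem (`contDiffAt_homNorm`). If
`z = d(-ln V(x)) x` is the projection to the unit sphere, the closed-loop field satisfies
`d(-ln V(x)) f(x) = V(x) ^ μ (A₀ + B K) z`, whence the matrix inequality for `X`, `Y` is precisely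
`DV(x) f(x) ≤ -ρ V(x) ^ (1 + μ)` (`fderiv_homNorm_homField_le`).

*Differential equations.* Off the origin the fields are `C¹`, so the Filippov inclusion is the
differential equation there. At the origin they may be discontinuous, but they are odd, so `0` always
belongs to the Filippov set (`zero_mem_filippov_of_odd`). Along any solution `V` is nonincreasing, and
a solution that has reached the origin stays there. Existence and uniqueness are obtained together from
truncated, globally Lipschitz fields that agree with `f` on a shell `ε ≤ V ≤ c`: the truncated problem
has a unique Carathéodory solution by a contraction in a weighted norm
(`exists_caratheodory_solution`), and every solution of the original problem follows it until both
are in `V ≤ ε` for good (`IsTruncatedSolution.eq_or_le`). Letting `ε → 0` gives uniqueness for every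
`μ` and, when `f` is locally bounded (`μ ≥ -1`), a limit that is a solution. The stability claims
are the integrated form of the decay of `V` (`IsSolution.primitive_le`): a primitive of
`w ^ (-(1 + μ))`, which is `-w ^ (-μ) / μ` or `log w`, decreases along `V(x(t))` at rate at least `ρ`.
-/

namespace SwitchedHom

/-! ### The homogenization equations -/

section Homogenization

variable {n m : ℕ} {A G₀ : Mat n n} {B : Mat n m} {Y₀ : Mat m n}

/-- Rows `wᵀ` annihilating `A ^ k * B` for all `k` vanish when `(A, B)` is controllable. -/
lemma Controllable.eq_zero_of_vecMul (h : Controllable A B) {w : Fin n → ℝ}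
    (hw : ∀ k : ℕ, w ᵥ* (A ^ k * B) = 0) : w = 0 := by
  have hli : LinearIndependent ℝ (controllabilityMatrix A B).row := by
    rw [linearIndependent_iff_card_eq_finrank_span, Set.finrank,
      ← Matrix.rank_eq_finrank_span_row, Fintype.card_fin]
    exact h.symm
  have hinj := Matrix.vecMul_injective_iff.2 hli
  refine hinj ?_
  simp only [zero_vecMul]
  ext kj
  have := congrFun (hw kj.1) kj.2
  simpa [controllabilityMatrix, vecMul, dotProduct] using this

/-- `1` is not an eigenvalue of `G₀`: a left eigenvector `w` for it would satisfy
`wᵀ A ^ k G₀ = (k + 1) wᵀ A ^ k`, whence `wᵀ A ^ k B = 0` for all `k`, against controllability. -/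
lemma isUnit_sub_one (hc : Controllable A B) (h : A * G₀ - G₀ * A + B * Y₀ = A)
    (hB : G₀ * B = 0) : IsUnit (G₀ - 1) := by
  rw [Matrix.isUnit_iff_isUnit_det, isUnit_iff_ne_zero]
  intro hdet
  obtain ⟨w, hw0, hw⟩ := Matrix.exists_vecMul_eq_zero_iff.2 hdet
  have hw1 : w ᵥ* G₀ = w := by
    rwa [Matrix.vecMul_sub, Matrix.vecMul_one, sub_eq_zero] at hw
  have hB' : ∀ (v : Fin n → ℝ) (c : ℝ), 0 < c → v ᵥ* G₀ = c • v → v ᵥ* B = 0 := by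
    intro v c hcpos hv
    have h1 : v ᵥ* (G₀ * B) = 0 := by rw [hB, Matrix.vecMul_zero]
    rw [← Matrix.vecMul_vecMul, hv, Matrix.smul_vecMul] at h1
    exact (smul_eq_zero.1 h1).resolve_left hcpos.ne'
  have key : ∀ k : ℕ, (w ᵥ* A ^ k) ᵥ* G₀ = ((k : ℝ) + 1) • (w ᵥ* A ^ k) := by
    intro k
    induction k with
    | zero => simpa using hw1
    | succ k ih =>
      set v := w ᵥ* A ^ k with hv
      have hvB := hB' v _ (by positivity) ih
      have hAG : A * G₀ = A + G₀ * A - B * Y₀ := by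
        rw [← sub_eq_zero] at h ⊢
        rw [← h]; abel
      rw [pow_succ, ← Matrix.vecMul_vecMul, ← hv, Matrix.vecMul_vecMul, hAG, Matrix.vecMul_sub,
        Matrix.vecMul_add, ← Matrix.vecMul_vecMul, ← Matrix.vecMul_vecMul v B, hvB, ih,
        Matrix.smul_vecMul, Matrix.zero_vecMul]
      push_cast
      module
  refine hw0 (hc.eq_zero_of_vecMul fun k => ?_)
  rw [← Matrix.vecMul_vecMul]
  exact hB' _ _ (by positivity) (key k)

lemma homogenized_commute (hU : IsUnit (G₀ - 1)) (h : A * G₀ - G₀ * A + B * Y₀ = A)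
    (hB : G₀ * B = 0) (μ : ℝ) :
    (A + B * (Y₀ * (G₀ - 1)⁻¹)) * (1 + μ • G₀) =
      ((1 + μ • G₀) + μ • (1 : Mat n n)) * (A + B * (Y₀ * (G₀ - 1)⁻¹)) := by
  have hinv : (G₀ - 1)⁻¹ * G₀ = 1 + (G₀ - 1)⁻¹ := by
    have := Matrix.nonsing_inv_mul (G₀ - 1) ((Matrix.isUnit_iff_isUnit_det _).1 hU)
    rw [Matrix.mul_sub, Matrix.mul_one, sub_eq_iff_eq_add] at this
    exact this
  set R := (G₀ - 1)⁻¹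
  have hG : (A + B * (Y₀ * R)) * G₀ = (G₀ + 1) * (A + B * (Y₀ * R)) := by
    have h1 : B * (Y₀ * R) * G₀ = B * Y₀ + B * (Y₀ * R) := by
      rw [Matrix.mul_assoc, Matrix.mul_assoc, hinv, Matrix.mul_add, Matrix.mul_add, Matrix.mul_one]
    have h2 : G₀ * (B * (Y₀ * R)) = 0 := by rw [← Matrix.mul_assoc, hB, Matrix.zero_mul]
    rw [Matrix.add_mul, Matrix.add_mul, Matrix.mul_add, h1, h2, Matrix.one_mul]
    rw [← sub_eq_zero] at h ⊢
    refine Eq.trans ?_ h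
    abel
  rw [Matrix.mul_add, Matrix.mul_smul, hG, Matrix.mul_one, Matrix.add_mul, Matrix.add_mul,
    Matrix.add_mul, Matrix.smul_mul, Matrix.smul_mul, Matrix.one_mul]
  module

/-- The spectrum of `G₀` is bounded, so `1 + μ G₀` has its spectrum near `1` for small `μ`. -/
lemma exists_antiHurwitz (G₀ : Mat n n) :
    ∃ ε > 0, ∀ μ : ℝ, |μ| < ε → AntiHurwitz (1 + μ • G₀) := by
  let _ : NormedRing (Matrix (Fin n) (Fin n) ℂ) := Matrix.linftyOpNormedRing
  let _ : NormedAlgebra ℂ (Matrix (Fin n) (Fin n) ℂ) := Matrix.linftyOpNormedAlgebra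
  set M := G₀.map (algebraMap ℝ ℂ) with hM
  set R := ‖M‖ * ‖(1 : Matrix (Fin n) (Fin n) ℂ)‖ with hR
  have hR0 : 0 ≤ R := by positivity
  refine ⟨(R + 1)⁻¹, by positivity, fun μ hμ z hz => ?_⟩
  have hmap : (1 + μ • G₀).map (algebraMap ℝ ℂ) = algebraMap ℂ _ 1 + (μ : ℂ) • M := by
    ext i j
    simp [hM, Matrix.one_apply, apply_ite]
  rw [hmap] at hz
  have hz' : z - 1 ∈ spectrum ℂ ((μ : ℂ) • M) := by
    rw [spectrum.mem_iff] at hz ⊢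
    convert hz using 2
    rw [map_sub]
    abel
  have hnorm : ‖z - 1‖ < 1 := by
    have h1 := spectrum.norm_le_norm_mul_of_mem hz'
    have h2 : ‖(μ : ℂ) • M‖ ≤ |μ| * ‖M‖ := by
      simpa using norm_smul_le (μ : ℂ) M
    calc ‖z - 1‖ ≤ |μ| * ‖M‖ * ‖(1 : Matrix (Fin n) (Fin n) ℂ)‖ := h1.trans (by gcongr)
      _ = |μ| * R := by rw [hR]; ring
      _ ≤ |μ| * (R + 1) := by gcongr; linarith
      _ < (R + 1)⁻¹ * (R + 1) := by gcongr
      _ = 1 := inv_mul_cancel₀ (by positivity)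
  have h3 := (abs_le.1 (Complex.abs_re_le_norm (z - 1))).1
  simp only [Complex.sub_re, Complex.one_re] at h3
  linarith

end Homogenization

/-! ### Absolutely continuous curves -/

section AbsolutelyContinuous

variable {X Y : Type*} [PseudoMetricSpace X] [PseudoMetricSpace Y]

lemma absolutelyContinuousOnInterval_comp_lipschitz {x : ℝ → X} {g : X → Y} {a b : ℝ} {K : NNReal}
    (hg : LipschitzOnWith K g (x '' Set.uIcc a b)) (hx : AbsolutelyContinuousOnInterval x a b) :
    AbsolutelyContinuousOnInterval (fun t => g (x t)) a b := by
  rw [absolutelyContinuousOnInterval_iff] at hx ⊢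
  intro ε hε
  obtain ⟨δ, hδ, h⟩ := hx (ε / (K + 1)) (by positivity)
  refine ⟨δ, hδ, fun E hE hlt => ?_⟩
  calc ∑ i ∈ Finset.range E.1, dist (g (x (E.2 i).1)) (g (x (E.2 i).2))
      ≤ ∑ i ∈ Finset.range E.1, K * dist (x (E.2 i).1) (x (E.2 i).2) :=
        Finset.sum_le_sum fun i hi =>
          hg.dist_le_mul _ ⟨_, (hE.1 i hi).1, rfl⟩ _ ⟨_, (hE.1 i hi).2, rfl⟩
    _ = K * ∑ i ∈ Finset.range E.1, dist (x (E.2 i).1) (x (E.2 i).2) :=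
        (Finset.mul_sum _ _ _).symm
    _ ≤ K * (ε / (K + 1)) := by gcongr; exact (h E hE hlt).le
    _ < (K + 1) * (ε / (K + 1)) := by gcongr; linarith
    _ = ε := by field_simp

lemma absolutelyContinuousOnInterval_comp_mul {x : ℝ → X} {a b c : ℝ} (hc : 0 < c)
    (hx : AbsolutelyContinuousOnInterval x (c * a) (c * b)) :
    AbsolutelyContinuousOnInterval (fun t => x (c * t)) a b := by
  rw [absolutelyContinuousOnInterval_iff] at hx ⊢
  intro ε hε
  obtain ⟨δ, hδ, h⟩ := hx ε hε
  have hIcc : ∀ {p q t : ℝ}, t ∈ Set.uIcc p q → c * t ∈ Set.uIcc (c * p) (c * q) := by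
    intro p q t ht
    rw [Set.mem_uIcc] at ht ⊢
    exact ht.imp (fun h => ⟨by gcongr; exact h.1, by gcongr; exact h.2⟩)
      (fun h => ⟨by gcongr; exact h.1, by gcongr; exact h.2⟩)
  refine ⟨δ / c, by positivity, fun E hE hlt => ?_⟩
  refine h (E.1, fun i => (c * (E.2 i).1, c * (E.2 i).2)) ⟨?_, ?_⟩ ?_
  · exact fun i hi => ⟨hIcc (hE.1 i hi).1, hIcc (hE.1 i hi).2⟩
  · intro i hi j hj hij
    have hd := Set.disjoint_left.1 (hE.2 hi hj hij)
    refine Set.disjoint_left.2 fun t hti htj => ?_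
    have hdiv : ∀ {p q : ℝ}, t ∈ Set.uIoc (c * p) (c * q) → t / c ∈ Set.uIoc p q := by
      intro p q ht
      rw [Set.mem_uIoc] at ht ⊢
      simp only [lt_div_iff₀ hc, div_le_iff₀ hc, mul_comm _ c]
      exact ht
    exact hd (hdiv hti) (hdiv htj)
  · simp only [Real.dist_eq, ← mul_sub, abs_mul, abs_of_pos hc, ← Finset.mul_sum]
    simp only [Real.dist_eq] at hlt
    rwa [lt_div_iff₀ hc, mul_comm] at hlt

lemma le_of_ae_hasDerivAt_nonpos {φ : ℝ → ℝ} {a b : ℝ} (hab : a ≤ b)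
    (hφ : AbsolutelyContinuousOnInterval φ a b)
    (hd : ∀ᵐ t, t ∈ Set.Ioo a b → ∃ v, HasDerivAt φ v t ∧ v ≤ 0) : φ b ≤ φ a := by
  have h1 := hφ.integral_deriv_eq_sub
  have h2 : ∫ t in a..b, deriv φ t ≤ ∫ _ in a..b, (0 : ℝ) := by
    refine intervalIntegral.integral_mono_ae_restrict hab hφ.intervalIntegrable_deriv (by simp) ?_
    rw [← restrict_Ioo_eq_restrict_Icc]
    refine (ae_restrict_iff' measurableSet_Ioo).2 ?_
    filter_upwards [hd] with t ht htm
    obtain ⟨v, hv, hv0⟩ := ht htm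
    rw [hv.deriv]
    exact hv0
  simp only [intervalIntegral.integral_zero] at h2
  linarith

/-- A nonnegative continuous function that is absolutely continuous and has nonpositive derivative
as long as it is positive is nonincreasing. In particular it cannot leave `0`. -/
lemma antitoneOn_of_decreasing_while_pos {W : ℝ → ℝ} {a : ℝ} (hc : ContinuousOn W (Set.Ici a))
    (h0 : ∀ t, 0 ≤ W t)
    (hac : ∀ s t, a ≤ s → s ≤ t → (∀ r ∈ Set.Icc s t, 0 < W r) →
      AbsolutelyContinuousOnInterval W s t)
    (hd : ∀ᵐ t, a ≤ t → 0 < W t → ∃ v, HasDerivAt W v t ∧ v ≤ 0) :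
    AntitoneOn W (Set.Ici a) := by
  have step : ∀ s t, a ≤ s → s ≤ t → (∀ r ∈ Set.Icc s t, 0 < W r) → W t ≤ W s := by
    intro s t has hst hpos
    refine le_of_ae_hasDerivAt_nonpos hst (hac s t has hst hpos) ?_
    filter_upwards [hd] with r hr hrm
    exact hr (has.trans hrm.1.le) (hpos r ⟨hrm.1.le, hrm.2.le⟩)
  intro s hs t ht hst
  by_contra! hlt
  have hWt : 0 < W t := (h0 s).trans_lt hlt
  set Z := {r | r ∈ Set.Icc s t ∧ W r = 0} with hZ
  rcases Z.eq_empty_or_nonempty with hempty | hne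
  · refine hlt.not_ge (step s t hs hst fun r hr => (h0 r).lt_of_ne' fun hr0 => ?_)
    exact (Set.eq_empty_iff_forall_notMem.1 hempty r) ⟨hr, hr0⟩
  · have hcst : ContinuousOn W (Set.Icc s t) := hc.mono fun r hr => le_trans hs hr.1
    have hZc : IsCompact Z := by
      have : Z = Set.Icc s t ∩ W ⁻¹' {0} := by ext; simp [hZ]
      rw [this]
      exact isCompact_Icc.of_isClosed_subset
        (hcst.preimage_isClosed_of_isClosed isClosed_Icc isClosed_singleton) Set.inter_subset_left
    -- `r` is the last zero before `t`; on `(r, t]` the function is positive and decreasing.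
    obtain ⟨r, ⟨hrm, hr0⟩, hmax⟩ := hZc.exists_isGreatest hne
    have hrt : r < t := lt_of_le_of_ne hrm.2 (by rintro rfl; exact hWt.ne' hr0)
    have hge : ∀ᶠ q in 𝓝[>] r, W t ≤ W q := by
      filter_upwards [Ioc_mem_nhdsGT hrt] with q hq
      refine step q t (le_trans hs (hrm.1.trans hq.1.le)) hq.2 fun p hp => ?_
      refine (h0 p).lt_of_ne' fun hp0 => ?_
      exact (hmax ⟨⟨hrm.1.trans (hq.1.le.trans hp.1), hp.2⟩, hp0⟩).not_gt (hq.1.trans_le hp.1)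
    have hlim : Tendsto W (𝓝[>] r) (𝓝 (W r)) :=
      (hc r (le_trans hs hrm.1)).mono_left
        (nhdsWithin_mono _ fun q hq => le_trans (le_trans hs hrm.1) (le_of_lt hq))
    have := ge_of_tendsto hlim hge
    rw [hr0] at this
    exact this.not_gt hWt

end AbsolutelyContinuous

/-! ### Carathéodory equations with a bounded Lipschitz right-hand side -/

section Caratheodory

variable {E : Type*} [NormedAddCommGroup E] [InnerProductSpace ℝ E]

/-- Uniqueness for `ẋ = g(t, x)` in the class of absolutely continuous curves: `e^{-2 L t} ‖x - y‖²`
is nonincreasing. -/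
lemma eqOn_of_ae_hasDerivAt_lipschitz {g : ℝ → E → E} {L : NNReal}
    (hg : ∀ t, LipschitzWith L (g t)) {x y : ℝ → E} {a b : ℝ} (hab : a ≤ b)
    (hx : AbsolutelyContinuousOnInterval x a b) (hy : AbsolutelyContinuousOnInterval y a b)
    (hx' : ∀ᵐ t, t ∈ Set.Ioo a b → HasDerivAt x (g t (x t)) t)
    (hy' : ∀ᵐ t, t ∈ Set.Ioo a b → HasDerivAt y (g t (y t)) t) (h0 : x a = y a) : x b = y b := by
  set e : ℝ → ℝ := fun t => ‖x t - y t‖ with he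
  have hsub : AbsolutelyContinuousOnInterval (fun t => x t - y t) a b := hx.sub hy
  have heac : AbsolutelyContinuousOnInterval e a b :=
    absolutelyContinuousOnInterval_comp_lipschitz (K := 1)
      (lipschitzWith_one_norm.lipschitzOnWith) hsub
  set w : ℝ → ℝ := fun t => Real.exp (-(2 * L * t)) with hw
  have hwac : AbsolutelyContinuousOnInterval w a b := by
    refine ContDiffOn.absolutelyContinuousOnInterval (ContDiff.contDiffOn ?_)
    rw [hw]; fun_prop
  have hφ : AbsolutelyContinuousOnInterval (fun t => w t * (e t * e t)) a b :=
    hwac.mul (heac.mul heac)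
  have hle := le_of_ae_hasDerivAt_nonpos hab hφ (by
    filter_upwards [hx', hy'] with t htx hty htm
    have h1 := ((htx htm).sub (hty htm)).norm_sq
    have h2 : HasDerivAt w (w t * -(2 * L)) t := by
      have : HasDerivAt (fun t : ℝ => -(2 * L * t)) (-(2 * L)) t := by
        exact ((hasDerivAt_id t).const_mul (2 * (L : ℝ))).neg.congr_deriv (by simp)
      exact this.exp
    refine ⟨_, (h2.mul h1).congr_of_eventuallyEq (Eventually.of_forall fun s => ?_), ?_⟩
    · simp [he, pow_two]
    · have h3 : inner ℝ (x t - y t) (g t (x t) - g t (y t)) ≤ L * ‖x t - y t‖ ^ 2 := by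
        refine (real_inner_le_norm _ _).trans ?_
        have := (hg t).norm_sub_le (x t) (y t)
        nlinarith [norm_nonneg (x t - y t)]
      have hwpos : 0 < w t := Real.exp_pos _
      simp only [Pi.sub_apply]
      nlinarith)
  have hea : e a = 0 := by simp [he, h0]
  simp only [hea, mul_zero] at hle
  have hwb : 0 < w b := Real.exp_pos _
  have : e b * e b ≤ 0 := by
    by_contra! hcon
    exact (mul_pos hwb hcon).not_ge hle
  have heb : e b = 0 := by nlinarith [norm_nonneg (x b - y b)]
  simpa [he, sub_eq_zero] using heb

end Caratheodory

section CaratheodoryExistence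

open scoped BoundedContinuousFunction

variable {E : Type*} [NormedAddCommGroup E] [NormedSpace ℝ E] [CompleteSpace E]

lemma locallyIntegrable_of_bounded {F : Type*} [NormedAddCommGroup F] {h : ℝ → F} {M : ℝ}
    (hm : AEStronglyMeasurable h volume) (hM : ∀ t, ‖h t‖ ≤ M) : LocallyIntegrable h volume :=
  (locallyIntegrable_const M).mono hm (Eventually.of_forall fun t =>
    (hM t).trans (le_abs_self M))

/-- Existence for `ẋ = g(t, x)` with `g` bounded and Lipschitz in `x`, on the whole half-line at
once: the Picard map is a contraction for the weighted norm `sup_t e^{-λ (t - a)} ‖x(t)‖`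
with `λ = 2 L + 1`. -/
lemma exists_caratheodory_solution {g : ℝ → E → E} {L M : NNReal}
    (hg : ∀ t, LipschitzWith L (g t)) (hM : ∀ t x, ‖g t x‖ ≤ M) {a : ℝ}
    (hmeas : ∀ x : ℝ → E, Continuous x →
      AEStronglyMeasurable (fun t => g t (x t)) (volume.restrict (Set.Ici a))) (x₀ : E) :
    ∃ x : ℝ → E, LipschitzWith M x ∧ (∀ t ≤ a, x t = x₀) ∧
      ∀ᵐ t, a ≤ t → HasDerivAt x (g t (x t)) t := by
  -- The right-hand side is switched off before the initial time.
  set g' : ℝ → E → E := fun t x => (Set.Ici a).indicator (fun t => g t x) t with hg'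
  have hLip : ∀ t x y, ‖g' t x - g' t y‖ ≤ L * ‖x - y‖ := by
    intro t x y
    by_cases ht : t ∈ Set.Ici a
    · simpa [hg', ht] using (hg t).norm_sub_le x y
    · simp only [hg', Set.indicator_of_notMem ht, sub_self, norm_zero]; positivity
  have hM' : ∀ t x, ‖g' t x‖ ≤ M := by
    intro t x
    by_cases ht : t ∈ Set.Ici a
    · simpa [hg', ht] using hM t x
    · simp only [hg', Set.indicator_of_notMem ht, norm_zero]; positivity
  have hloc : ∀ x : ℝ → E, Continuous x → LocallyIntegrable (fun t => g' t (x t)) volume := by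
    intro x hx
    refine locallyIntegrable_of_bounded ?_ fun t => hM' t (x t)
    exact (aestronglyMeasurable_indicator_iff measurableSet_Ici).2 (hmeas x hx)
  have hii : ∀ (x : ℝ → E), Continuous x → ∀ s t,
      IntervalIntegrable (fun t => g' t (x t)) volume s t := fun x hx s t =>
    (intervalIntegrable_iff.2 (((hloc x hx).integrableOn_isCompact isCompact_uIcc).mono_set
      Set.uIoc_subset_uIcc))
  set I : (ℝ → E) → ℝ → E := fun x t => x₀ + ∫ s in a..t, g' s (x s) with hI
  have hILip : ∀ x : ℝ → E, Continuous x → LipschitzWith M (I x) := by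
    intro x hx
    refine LipschitzWith.of_dist_le_mul fun s t => ?_
    rw [dist_eq_norm, hI]
    simp only [add_sub_add_left_eq_sub]
    rw [intervalIntegral.integral_interval_sub_left (hii x hx _ _) (hii x hx _ _), Real.dist_eq]
    exact intervalIntegral.norm_integral_le_of_norm_le_const fun r _ => hM' r (x r)
  have hIle : ∀ x : ℝ → E, ∀ t, t ≤ a → I x t = x₀ := by
    intro x t ht
    have : ∫ s in a..t, g' s (x s) = ∫ s in a..t, (0 : E) := by
      refine intervalIntegral.integral_congr_ae ?_
      have hne : ∀ᵐ s : ℝ, s ≠ a := by simp [ae_iff]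
      filter_upwards [hne] with s hs hsm
      rw [Set.uIoc_of_ge ht] at hsm
      have : s ∉ Set.Ici a := fun h => hs (le_antisymm hsm.2 h)
      simp [hg', this]
    simp [hI, this]
  set lam : ℝ := 2 * L + 1 with hlam
  have hlam0 : 0 < lam := by positivity
  set w : ℝ → ℝ := fun t => Real.exp (lam * max (t - a) 0) with hw
  have hwpos : ∀ t, 0 < w t := fun t => Real.exp_pos _
  have hw1 : ∀ t, 1 ≤ w t := fun t => Real.one_le_exp (by positivity)
  have hwc : Continuous w := by rw [hw]; fun_prop
  have hbound : ∀ x : ℝ → E, Continuous x → ∀ t,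
      ‖(w t)⁻¹ • I x t‖ ≤ ‖x₀‖ + M / lam := by
    intro x hx t
    have h1 : ‖I x t‖ ≤ ‖x₀‖ + M * max (t - a) 0 := by
      rcases le_total t a with ht | ht
      · rw [hIle x t ht]; have := le_max_right (t - a) 0; nlinarith [M.2]
      · have := (hILip x hx).dist_le_mul t a
        rw [hIle x a le_rfl, Real.dist_eq, abs_of_nonneg (sub_nonneg.2 ht), dist_eq_norm] at this
        have h2 := norm_le_norm_add_norm_sub' (I x t) x₀
        rw [max_eq_left (sub_nonneg.2 ht)]
        linarith
    have h2 : lam * max (t - a) 0 ≤ w t := by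
      have := Real.add_one_le_exp (lam * max (t - a) 0)
      simp only [hw]; linarith
    rw [norm_smul, norm_inv, Real.norm_of_nonneg (hwpos t).le, inv_mul_le_iff₀ (hwpos t)]
    have h3 : M * max (t - a) 0 ≤ w t * (M / lam) := by
      rw [mul_div_assoc', le_div_iff₀ hlam0]
      calc M * max (t - a) 0 * lam = M * (lam * max (t - a) 0) := by ring
        _ ≤ M * w t := by gcongr
        _ = w t * M := mul_comm _ _
    have h4 : ‖x₀‖ ≤ w t * ‖x₀‖ := le_mul_of_one_le_left (norm_nonneg _) (hw1 t)
    linarith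
  have hwy : ∀ y : ℝ →ᵇ E, Continuous fun t => w t • y t := fun y => hwc.smul y.continuous
  let F : (ℝ →ᵇ E) → (ℝ →ᵇ E) := fun y =>
    BoundedContinuousFunction.ofNormedAddCommGroup
      (fun t => (w t)⁻¹ • I (fun s => w s • y s) t)
      ((hwc.inv₀ fun t => (hwpos t).ne').smul (hILip _ (hwy y)).continuous)
      (‖x₀‖ + M / lam) (hbound _ (hwy y))
  have hF : ContractingWith (1 / 2 : NNReal) F := by
    refine ⟨by rw [← NNReal.coe_lt_coe]; norm_num, LipschitzWith.of_dist_le_mul fun y z => ?_⟩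
    refine (BoundedContinuousFunction.dist_le (by positivity)).2 fun t => ?_
    have hyz : ∀ s, ‖y s - z s‖ ≤ dist y z := fun s => by
      rw [← dist_eq_norm]; exact BoundedContinuousFunction.dist_coe_le_dist s
    have hcoe : dist (F y t) (F z t) =
        (w t)⁻¹ * ‖I (fun s => w s • y s) t - I (fun s => w s • z s) t‖ := by
      change dist ((w t)⁻¹ • I (fun s => w s • y s) t) ((w t)⁻¹ • I (fun s => w s • z s) t) = _
      rw [dist_eq_norm, ← smul_sub, norm_smul, norm_inv, Real.norm_of_nonneg (hwpos t).le]
    rw [hcoe, inv_mul_le_iff₀ (hwpos t)]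
    push_cast
    rcases le_total t a with ht | ht
    · rw [hIle _ t ht, hIle _ t ht, sub_self, norm_zero]
      have := (hwpos t).le
      positivity
    · have hexp : ∫ s in a..t, L * dist y z * Real.exp (lam * (s - a)) =
          L * dist y z * ((Real.exp (lam * (t - a)) - 1) / lam) := by
        rw [intervalIntegral.integral_const_mul]
        congr 1
        have hder : ∀ s ∈ Set.uIcc a t, HasDerivAt (fun s => Real.exp (lam * (s - a)) / lam)
            (Real.exp (lam * (s - a))) s := by
          intro s _
          have h1 : HasDerivAt (fun s : ℝ => lam * (s - a)) lam s := by
            simpa using ((hasDerivAt_id s).sub_const a).const_mul lam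
          exact (h1.exp.div_const lam).congr_deriv (mul_div_cancel_right₀ _ hlam0.ne')
        rw [intervalIntegral.integral_eq_sub_of_hasDerivAt hder
          (Continuous.intervalIntegrable (by fun_prop) _ _)]
        simp [sub_div]
      simp only [hI, add_sub_add_left_eq_sub]
      rw [← intervalIntegral.integral_sub (hii _ (hwy y) _ _) (hii _ (hwy z) _ _)]
      calc ‖∫ s in a..t, (g' s (w s • y s) - g' s (w s • z s))‖
          ≤ ∫ s in a..t, L * dist y z * Real.exp (lam * (s - a)) := by
            refine intervalIntegral.norm_integral_le_of_norm_le ht ?_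
              (Continuous.intervalIntegrable (by fun_prop) _ _)
            refine Eventually.of_forall fun s hs => ?_
            have hws : w s = Real.exp (lam * (s - a)) := by
              simp only [hw]; rw [max_eq_left (sub_nonneg.2 hs.1.le)]
            calc _ ≤ L * ‖w s • y s - w s • z s‖ := hLip s _ _
              _ = L * (w s * ‖y s - z s‖) := by
                  rw [← smul_sub, norm_smul, Real.norm_of_nonneg (hwpos s).le]
              _ ≤ L * (w s * dist y z) := by
                  have := (hwpos s).le; gcongr; exact hyz s
              _ = _ := by rw [hws]; ring
        _ = L * dist y z * ((Real.exp (lam * (t - a)) - 1) / lam) := hexp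
        _ ≤ w t * (1 / 2 * dist y z) := by
            have hwt : w t = Real.exp (lam * (t - a)) := by
              simp only [hw]; rw [max_eq_left (sub_nonneg.2 ht)]
            rw [hwt, mul_div_assoc', div_le_iff₀ hlam0]
            have hd : 0 ≤ dist y z := dist_nonneg
            have he := Real.exp_pos (lam * (t - a))
            have hL : 0 ≤ (L : ℝ) := L.2
            have h5 : 0 ≤ L * dist y z := by positivity
            have h6 : 0 ≤ Real.exp (lam * (t - a)) * dist y z := by positivity
            rw [hlam] at *
            nlinarith
  obtain ⟨y, hy⟩ : ∃ y, F y = y := ⟨_, hF.fixedPoint_isFixedPt⟩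
  set x : ℝ → E := fun t => w t • y t with hx
  have hxc : Continuous x := hwy y
  have hfix : ∀ t, x t = I x t := by
    intro t
    have h1 : (w t)⁻¹ • I x t = y t := congrArg (fun z : ℝ →ᵇ E => z t) hy
    calc x t = w t • y t := rfl
      _ = I x t := by rw [← h1, smul_inv_smul₀ (hwpos t).ne']
  refine ⟨x, ?_, ?_, ?_⟩
  · have := hILip x hxc
    rwa [← funext hfix] at this
  · exact fun t ht => by rw [hfix, hIle x t ht]
  · filter_upwards [LocallyIntegrable.ae_hasDerivAt_integral (hloc x hxc)] with t ht hat
    have h1 : HasDerivAt (I x) (g' t (x t)) t := (ht a).const_add x₀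
    rw [← funext hfix] at h1
    simpa [hg', hat] using h1

end CaratheodoryExistence

/-! ### Filippov regularization -/

section Filippov

variable {n : ℕ} {g : Vec n → Vec n}

lemma nonempty_ball_diff_null (x : Vec n) {δ : ℝ} (hδ : 0 < δ) {S : Set (Vec n)}
    (hS : volume S = 0) : (Metric.ball x δ \ S).Nonempty := by
  refine nonempty_of_measure_ne_zero (μ := volume) ?_
  rw [measure_sdiff_null hS]
  exact (Metric.measure_ball_pos volume x hδ).ne'

lemma mem_filippov {x v : Vec n} : v ∈ filippov g x ↔ ∀ δ > 0, ∀ S : Set (Vec n), volume S = 0 →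
    v ∈ closure (convexHull ℝ (g '' (Metric.ball x δ \ S))) := by
  simp only [filippov, Set.mem_iInter]

/-- At a point of continuity the Filippov regularization is single-valued. -/
lemma filippov_eq_singleton {x : Vec n} (hg : ContinuousAt g x) : filippov g x = {g x} := by
  refine Set.eq_singleton_iff_unique_mem.2 ⟨mem_filippov.2 fun δ hδ S hS => ?_, fun v hv => ?_⟩
  · refine closure_mono (subset_convexHull ℝ _) (Metric.mem_closure_iff.2 fun ε hε => ?_)
    obtain ⟨η, hη, h⟩ := Metric.continuousAt_iff.1 hg ε hε
    obtain ⟨y, hy, hyS⟩ := nonempty_ball_diff_null x (lt_min hδ hη) hS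
    have hy' := lt_min_iff.1 (Metric.mem_ball.1 hy)
    exact ⟨g y, ⟨y, ⟨hy'.1, hyS⟩, rfl⟩, by rw [dist_comm]; exact h hy'.2⟩
  · refine eq_of_forall_dist_le fun ε hε => ?_
    obtain ⟨η, hη, h⟩ := Metric.continuousAt_iff.1 hg ε hε
    have hsub : closure (convexHull ℝ (g '' (Metric.ball x η \ ∅))) ⊆ Metric.closedBall (g x) ε := by
      refine closure_minimal (convexHull_min ?_ (convex_closedBall _ _)) Metric.isClosed_closedBall
      rintro _ ⟨y, hy, rfl⟩
      exact (h hy.1).le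
    exact hsub (mem_filippov.1 hv η hη ∅ (by simp))

/-- For an odd vector field, however badly it behaves at the origin, the origin is an equilibrium in
the sense of Filippov: `0` is the midpoint of `g x` and `g (-x)`. -/
lemma zero_mem_filippov_of_odd (hg : ∀ x, g (-x) = -g x) : (0 : Vec n) ∈ filippov g 0 := by
  refine mem_filippov.2 fun δ hδ S hS => subset_closure ?_
  have hnull : volume (S ∪ Neg.neg ⁻¹' S) = 0 := by
    rw [measure_union_null_iff]
    exact ⟨hS, (Measure.measurePreserving_neg volume).quasiMeasurePreserving.preimage_null hS⟩
  obtain ⟨y, hy, hyS⟩ := nonempty_ball_diff_null (0 : Vec n) hδ hnull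
  rw [Set.mem_union, not_or] at hyS
  have h1 : g y ∈ g '' (Metric.ball 0 δ \ S) := ⟨y, ⟨hy, hyS.1⟩, rfl⟩
  have h2 : -g y ∈ g '' (Metric.ball 0 δ \ S) := by
    refine ⟨-y, ⟨?_, hyS.2⟩, hg y⟩
    simpa using hy
  have h3 := (convex_convexHull ℝ (g '' (Metric.ball 0 δ \ S)))
    (subset_convexHull ℝ _ h1) (subset_convexHull ℝ _ h2) (a := 1 / 2) (b := 1 / 2)
    (by norm_num) (by norm_num) (by norm_num)
  simpa using h3

/-- The Filippov regularization inherits the symmetries of the vector field. -/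
lemma smul_mem_filippov_of_semiconj {T : Vec n →ₗ[ℝ] Vec n} (hT : LinearMap.det T ≠ 0) {c : ℝ}
    (hg : ∀ x, g (T x) = c • T (g x)) {x v : Vec n} (hv : v ∈ filippov g x) :
    c • T v ∈ filippov g (T x) := by
  refine mem_filippov.2 fun δ hδ S hS => ?_
  have hTc : Continuous T := T.continuous_of_finiteDimensional
  obtain ⟨η, hη, h⟩ := Metric.continuousAt_iff.1 (hTc.continuousAt (x := x)) δ hδ
  have hnull : volume (T ⁻¹' S) = 0 := by
    rw [Measure.addHaar_preimage_linearMap _ hT, hS, mul_zero]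
  have hmem := mem_filippov.1 hv η hη _ hnull
  set T' : Vec n →ₗ[ℝ] Vec n := c • T with hT'
  have hT'c : Continuous T' := T'.continuous_of_finiteDimensional
  have h1 := image_closure_subset_closure_image hT'c ⟨v, hmem, rfl⟩
  rw [T'.image_convexHull] at h1
  refine closure_mono (convexHull_mono ?_) h1
  rintro _ ⟨_, ⟨y, hy, rfl⟩, rfl⟩
  exact ⟨T y, ⟨h hy.1, hy.2⟩, hg y⟩

end Filippov

/-! ### Lyapunov functions and Filippov solutions -/

section Lyapunov

variable {n N : ℕ} {f : Fin N → Vec n → Vec n} {V : Vec n → ℝ}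

lemma absolutelyContinuous_continuousOn {x : ℝ → Vec n} {t₀ : ℝ}
    (hx : ∀ T, t₀ ≤ T → AbsolutelyContinuousOnInterval x t₀ T) : ContinuousOn x (Set.Ici t₀) := by
  intro t ht
  have ht' : t₀ ≤ t := ht
  have h1 := (hx (t + 1) (by linarith)).continuousOn
  rw [Set.uIcc_of_le (by linarith)] at h1
  refine (h1 t ⟨ht', by linarith⟩).mono_of_mem_nhdsWithin ?_
  have : Set.Iio (t + 1) ∈ 𝓝 t := Iio_mem_nhds (by linarith)
  filter_upwards [self_mem_nhdsWithin, mem_nhdsWithin_of_mem_nhds this] with s hs hs'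
  exact ⟨hs, le_of_lt hs'⟩

lemma IsCommonLyapunov.nonneg (hV : IsCommonLyapunov f V) (x : Vec n) : 0 ≤ V x := by
  rcases eq_or_ne x 0 with rfl | hx
  · exact hV.zero.ge
  · exact (hV.pos x hx).le

lemma IsCommonLyapunov.eq_zero (hV : IsCommonLyapunov f V) {x : Vec n} (hx : V x ≤ 0) : x = 0 := by
  by_contra h
  exact (hV.pos x h).not_ge hx

lemma IsCommonLyapunov.ne_zero (hV : IsCommonLyapunov f V) {x : Vec n} (hx : 0 < V x) : x ≠ 0 := by
  rintro rfl
  exact hx.ne' hV.zero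

lemma IsCommonLyapunov.hasFDerivAt (hV : IsCommonLyapunov f V) {x : Vec n} (hx : x ≠ 0) :
    HasFDerivAt V (fderiv ℝ V x) x :=
  ((hV.smooth.contDiffAt (isOpen_compl_singleton.mem_nhds hx)).differentiableAt
    one_ne_zero).hasFDerivAt

lemma IsCommonLyapunov.isCompact_sublevel (hV : IsCommonLyapunov f V) (c : ℝ) :
    IsCompact {x | V x ≤ c} := by
  have h1 := hV.radial (Ioi_mem_atTop c)
  rw [mem_map, mem_cocompact] at h1
  obtain ⟨K, hK, hsub⟩ := h1
  refine hK.of_isClosed_subset (isClosed_le hV.cont continuous_const) fun x hx => ?_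
  by_contra hxK
  exact absurd (show c < V x from hsub hxK) (not_lt.2 hx)

/-- Small values of a Lyapunov function mean small states. -/
lemma IsCommonLyapunov.exists_norm_le (hV : IsCommonLyapunov f V) {ε : ℝ} (hε : 0 < ε) :
    ∃ c > 0, ∀ x, V x ≤ c → ‖x‖ ≤ ε := by
  have hcl : IsCompact ({x | V x ≤ 1} ∩ {x | ε ≤ ‖x‖}) :=
    (hV.isCompact_sublevel 1).inter_right (isClosed_le continuous_const continuous_norm)
  rcases ({x | V x ≤ 1} ∩ {x | ε ≤ ‖x‖}).eq_empty_or_nonempty with he | hne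
  · refine ⟨1, one_pos, fun x hx => ?_⟩
    by_contra! hlt
    exact (Set.eq_empty_iff_forall_notMem.1 he x) ⟨hx, hlt.le⟩
  · obtain ⟨y, hy, hmin⟩ := hcl.exists_isMinOn hne hV.cont.continuousOn
    have hypos : 0 < V y := hV.pos y (by rintro rfl; simpa using hε.trans_le hy.2)
    refine ⟨V y / 2, by positivity, fun x hx => ?_⟩
    by_contra! hlt
    have : V y ≤ V x := hmin ⟨(by have := hy.1; simp only [Set.mem_ofPred_eq] at *; linarith), hlt.le⟩
    linarith

lemma IsCommonLyapunov.exists_norm_le_of_le (hV : IsCommonLyapunov f V) (c : ℝ) :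
    ∃ M > 0, ∀ x, V x ≤ c → ‖x‖ ≤ M := by
  obtain ⟨M, hM, h⟩ := (hV.isCompact_sublevel c).isBounded.exists_pos_norm_le
  exact ⟨M, hM, fun x hx => h x hx⟩

lemma IsCommonLyapunov.exists_le_of_norm_le (hV : IsCommonLyapunov f V) (R : ℝ) :
    ∃ c > 0, ∀ x : Vec n, ‖x‖ ≤ R → V x ≤ c := by
  obtain ⟨c, hc⟩ := (isCompact_closedBall (0 : Vec n) R).bddAbove_image hV.cont.continuousOn
  refine ⟨max c 1, by positivity, fun x hx => le_max_of_le_left (hc ⟨x, by simpa using hx, rfl⟩)⟩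

lemma IsCommonLyapunov.exists_le_of_norm_le_pos (hV : IsCommonLyapunov f V) {c : ℝ} (hc : 0 < c) :
    ∃ δ > 0, ∀ x : Vec n, ‖x‖ ≤ δ → V x ≤ c := by
  have h1 : ∀ᶠ x in 𝓝 (0 : Vec n), V x < c :=
    hV.cont.continuousAt.eventually_lt continuousAt_const (by rw [hV.zero]; exact hc)
  obtain ⟨δ, hδ, h⟩ := Metric.eventually_nhds_iff.1 h1
  refine ⟨δ / 2, by positivity, fun x hx => (h ?_).le⟩
  rw [dist_zero_right]; linarith

/-- Along an absolutely continuous curve away from the origin, a Lyapunov function is absolutely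
continuous. -/
lemma IsCommonLyapunov.absolutelyContinuous_comp (hV : IsCommonLyapunov f V) {x : ℝ → Vec n}
    {s t : ℝ} (hx : AbsolutelyContinuousOnInterval x s t) (hpos : ∀ r ∈ Set.uIcc s t, x r ≠ 0) :
    AbsolutelyContinuousOnInterval (fun r => V (x r)) s t := by
  have hloc : LocallyLipschitzOn (x '' Set.uIcc s t) V := by
    rintro _ ⟨r, hr, rfl⟩
    obtain ⟨K, U, hU, hL⟩ := (hV.smooth.contDiffAt
      (isOpen_compl_singleton.mem_nhds (hpos r hr))).exists_lipschitzOnWith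
    exact ⟨K, U, mem_nhdsWithin_of_mem_nhds hU, hL⟩
  obtain ⟨K, hK⟩ := hloc.exists_lipschitzOnWith_of_compact
    (isCompact_uIcc.image_of_continuousOn hx.continuousOn)
  exact absolutelyContinuousOnInterval_comp_lipschitz hK hx

lemma IsCommonLyapunov.antitoneOn (hV : IsCommonLyapunov f V) {x : ℝ → Vec n} {t₀ : ℝ}
    (hx : ∀ T, t₀ ≤ T → AbsolutelyContinuousOnInterval x t₀ T)
    (hd : ∀ᵐ t, t₀ ≤ t → x t ≠ 0 → ∃ v, HasDerivAt x v t ∧ fderiv ℝ V (x t) v ≤ 0) :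
    AntitoneOn (fun t => V (x t)) (Set.Ici t₀) := by
  refine antitoneOn_of_decreasing_while_pos
    (hV.cont.comp_continuousOn (absolutelyContinuous_continuousOn hx)) (fun t => hV.nonneg _) ?_ ?_
  · intro s t hs hst hpos
    have hsub : Set.uIcc s t ⊆ Set.uIcc t₀ t := by
      rw [Set.uIcc_of_le hst, Set.uIcc_of_le (hs.trans hst)]
      exact Set.Icc_subset_Icc_left hs
    refine hV.absolutelyContinuous_comp ((hx t (hs.trans hst)).mono hsub) fun r hr => ?_
    rw [Set.uIcc_of_le hst] at hr
    exact hV.ne_zero (hpos r hr)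
  · filter_upwards [hd] with t ht h0 hpos
    obtain ⟨v, hv, hle⟩ := ht h0 (hV.ne_zero hpos)
    exact ⟨_, (hV.hasFDerivAt (hV.ne_zero hpos)).comp_hasDerivAt t hv, hle⟩

/-- Away from the origin a Filippov solution satisfies the differential equation. -/
lemma IsSolution.ae_hasDerivAt {σ : ℝ → Fin N} {t₀ : ℝ} {x : ℝ → Vec n}
    (hx : IsSolution f σ t₀ x) (hf : ∀ i y, y ≠ 0 → ContinuousAt (f i) y) :
    ∀ᵐ t, t₀ ≤ t → x t ≠ 0 → HasDerivAt x (f (σ t) (x t)) t := by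
  filter_upwards [(ae_restrict_iff' measurableSet_Ici).1 hx.inclusion] with t ht h0 hne
  obtain ⟨v, hv, hd⟩ := ht h0
  rw [filippov_eq_singleton (hf _ _ hne), Set.mem_singleton_iff] at hv
  rwa [hv] at hd

lemma IsSolution.antitoneOn {σ : ℝ → Fin N} {t₀ : ℝ} {x : ℝ → Vec n}
    (hx : IsSolution f σ t₀ x) (hf : ∀ i y, y ≠ 0 → ContinuousAt (f i) y)
    (hV : IsCommonLyapunov f V) : AntitoneOn (fun t => V (x t)) (Set.Ici t₀) := by
  refine hV.antitoneOn hx.absCont ?_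
  filter_upwards [hx.ae_hasDerivAt hf] with t ht h0 hne
  exact ⟨_, ht h0 hne, (hV.decay _ _ hne).le⟩

/-- Integrated form of the differential inequality `d/dt V(x) ≤ -ρ V(x) ^ (1 + μ)`: a primitive `H`
of `w ^ (-(1 + μ))` decreases along `V(x)` at least at the rate `ρ`. -/
lemma IsSolution.primitive_le {σ : ℝ → Fin N} {t₀ : ℝ} {x : ℝ → Vec n}
    (hx : IsSolution f σ t₀ x) (hf : ∀ i y, y ≠ 0 → ContinuousAt (f i) y)
    (hV : IsCommonLyapunov f V) {ρ μ : ℝ}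
    (hdec : ∀ i y, y ≠ 0 → fderiv ℝ V y (f i y) ≤ -ρ * V y ^ (1 + μ)) {H : ℝ → ℝ}
    (hH : ∀ w, 0 < w → HasDerivAt H (w ^ (-(1 + μ))) w) {t : ℝ} (ht : t₀ ≤ t) (hxt : x t ≠ 0) :
    H (V (x t)) ≤ H (V (x t₀)) - ρ * (t - t₀) := by
  have hanti := hx.antitoneOn hf hV
  have hpos : ∀ r ∈ Set.Icc t₀ t, x r ≠ 0 := fun r hr =>
    hV.ne_zero ((hV.pos _ hxt).trans_le (hanti hr.1 ht hr.2))
  have hVac : AbsolutelyContinuousOnInterval (fun r => V (x r)) t₀ t :=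
    hV.absolutelyContinuous_comp (hx.absCont t ht) (by rwa [Set.uIcc_of_le ht])
  have hloc : LocallyLipschitzOn ((fun r => V (x r)) '' Set.uIcc t₀ t) H := by
    rintro _ ⟨r, hr, rfl⟩
    rw [Set.uIcc_of_le ht] at hr
    have hw := hV.pos _ (hpos r hr)
    have hcd : ContDiffAt ℝ 1 H (V (x r)) := by
      have hev : ∀ᶠ w in 𝓝 (V (x r)), HasDerivAt H (w ^ (-(1 + μ))) w := by
        filter_upwards [Ioi_mem_nhds hw] with w hw using hH w hw
      refine contDiffAt_one_iff.2 ⟨fun w => ContinuousLinearMap.toSpanSingleton ℝ (w ^ (-(1 + μ))),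
        Set.Ioi 0, Ioi_mem_nhds hw, ?_, fun w hw => (hH w hw).hasFDerivAt⟩
      have h2 : ContinuousOn (fun w : ℝ => w ^ (-(1 + μ))) (Set.Ioi 0) := fun w hw =>
        (Real.continuousAt_rpow_const w _ (Or.inl (ne_of_gt hw))).continuousWithinAt
      exact (ContinuousLinearMap.toSpanSingletonCLE (𝕜 := ℝ) (E := ℝ)).continuous.comp_continuousOn
        h2
    obtain ⟨K, U, hU, hL⟩ := hcd.exists_lipschitzOnWith
    exact ⟨K, U, mem_nhdsWithin_of_mem_nhds hU, hL⟩
  obtain ⟨K, hK⟩ := hloc.exists_lipschitzOnWith_of_compact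
    (isCompact_uIcc.image_of_continuousOn hVac.continuousOn)
  have hHac := absolutelyContinuousOnInterval_comp_lipschitz hK hVac
  have hlin : AbsolutelyContinuousOnInterval (fun r => ρ * (r - t₀)) t₀ t :=
    ContDiffOn.absolutelyContinuousOnInterval (ContDiff.contDiffOn (by fun_prop))
  have hle := le_of_ae_hasDerivAt_nonpos ht (hHac.add hlin) (by
    filter_upwards [hx.ae_hasDerivAt hf] with r hr hrm
    have hne := hpos r ⟨hrm.1.le, hrm.2.le⟩
    have hw := hV.pos _ hne
    have h1 := (hV.hasFDerivAt hne).comp_hasDerivAt r (hr hrm.1.le hne)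
    have h2 := (hH _ hw).comp r h1
    have h3 : HasDerivAt (fun r => ρ * (r - t₀)) ρ r := by
      simpa using ((hasDerivAt_id r).sub_const t₀).const_mul ρ
    refine ⟨_, h2.add h3, ?_⟩
    have h4 : V (x r) ^ (-(1 + μ)) * V (x r) ^ (1 + μ) = 1 := by
      rw [← Real.rpow_add hw]; simp
    have h5 := mul_le_mul_of_nonneg_left (hdec (σ r) _ hne)
      (Real.rpow_nonneg hw.le (-(1 + μ)))
    have h6 : V (x r) ^ (-(1 + μ)) * (-ρ * V (x r) ^ (1 + μ)) = -ρ := by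
      rw [mul_left_comm, h4, mul_one]
    linarith)
  simp only [Pi.add_apply, sub_self, mul_zero, add_zero] at hle
  linarith

end Lyapunov

/-! ### Existence and uniqueness of solutions -/

section Existence

variable {n N : ℕ} {f g : Fin N → Vec n → Vec n} {V : Vec n → ℝ} {ε c : ℝ}

/-- `g` is a truncation of the family `f` to the shell `ε ≤ V ≤ c`: it is globally Lipschitz and
bounded, agrees with `f` on the shell and is a multiple `θ f` with `0 ≤ θ ≤ 1` elsewhere, with
`θ = 0` where `V > 2 c`. -/
structure IsTruncation (f : Fin N → Vec n → Vec n) (V : Vec n → ℝ) (ε c : ℝ)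
    (g : Fin N → Vec n → Vec n) : Prop where
  lipschitz : ∃ L, ∀ i, LipschitzWith L (g i)
  bounded : ∃ M : NNReal, ∀ i x, ‖g i x‖ ≤ M
  scale : ∀ i x, ∃ θ : ℝ, 0 ≤ θ ∧ θ ≤ 1 ∧ g i x = θ • f i x ∧ (2 * c < V x → θ = 0)
  eq_of_mem : ∀ i x, ε ≤ V x → V x ≤ c → g i x = f i x

lemma IsCommonLyapunov.exists_truncation (hV : IsCommonLyapunov f V)
    (hf : ∀ i, ContDiffOn ℝ 1 (f i) {0}ᶜ) (hε : 0 < ε) (hc : 0 < c) :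
    ∃ g, IsTruncation f V ε c g := by
  -- The first factor passes from `0` to `1` for `ε / 2 ≤ V ≤ ε`, the second from `1` to `0` for
  -- `c ≤ V ≤ 2 c`.
  set χ : Vec n → ℝ := fun x =>
    Real.smoothTransition (2 * V x / ε - 1) * Real.smoothTransition (2 - V x / c) with hχ
  set g : Fin N → Vec n → Vec n := fun i x => χ x • f i x with hg
  have hχ0 : ∀ x, V x ≤ ε / 2 → χ x = 0 := fun x hx => by
    have : 2 * V x / ε - 1 ≤ 0 := by rw [sub_nonpos, div_le_one hε]; linarith
    simp [hχ, Real.smoothTransition.zero_of_nonpos this]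
  have hχ2 : ∀ x, 2 * c ≤ V x → χ x = 0 := fun x hx => by
    have : 2 - V x / c ≤ 0 := by rw [sub_nonpos, le_div_iff₀ hc]; linarith
    simp [hχ, Real.smoothTransition.zero_of_nonpos this]
  have hsm : ∀ i, ContDiff ℝ 1 (g i) := by
    intro i
    refine contDiff_iff_contDiffAt.2 fun x => ?_
    rcases eq_or_ne x 0 with rfl | hx
    · have hev : ∀ᶠ y in 𝓝 (0 : Vec n), V y < ε / 2 :=
        hV.cont.continuousAt.eventually_lt continuousAt_const (by rw [hV.zero]; positivity)
      refine (contDiffAt_const (c := (0 : Vec n))).congr_of_eventuallyEq ?_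
      filter_upwards [hev] with y hy
      simp [hg, hχ0 y hy.le]
    · have h1 : ContDiffAt ℝ 1 V x := hV.smooth.contDiffAt (isOpen_compl_singleton.mem_nhds hx)
      have h2 := (hf i).contDiffAt (isOpen_compl_singleton.mem_nhds hx)
      have hs := Real.smoothTransition.contDiff (n := 1)
      have h3 : ContDiffAt ℝ 1 (fun y => 2 * V y / ε - 1) x :=
        ((contDiffAt_const.mul h1).div_const ε).sub contDiffAt_const
      have h4 : ContDiffAt ℝ 1 (fun y => 2 - V y / c) x :=
        contDiffAt_const.sub (h1.div_const c)
      have h5 : ContDiffAt ℝ 1 χ x :=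
        (hs.contDiffAt.comp x h3).mul (hs.contDiffAt.comp x h4)
      exact h5.smul h2
  have hcs : ∀ i, HasCompactSupport (g i) := fun i =>
    HasCompactSupport.intro (hV.isCompact_sublevel (2 * c)) fun x hx => by
      have : ¬ V x ≤ 2 * c := hx
      simp [hg, hχ2 x (not_le.1 this).le]
  choose L hL using fun i => (hsm i).lipschitzWith_of_hasCompactSupport (hcs i) one_ne_zero
  choose M hM using fun i => (hcs i).exists_bound_of_continuous (hsm i).continuous
  refine ⟨g, ⟨∑ i, L i, fun i => (hL i).weaken
    (Finset.single_le_sum (fun _ _ => zero_le) (Finset.mem_univ i))⟩,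
    ⟨∑ i, (M i).toNNReal, fun i x => ?_⟩, fun i x => ⟨χ x, ?_, ?_, rfl, fun h => hχ2 x h.le⟩,
    fun i x h1 h2 => ?_⟩
  · refine (hM i x).trans ((Real.le_coe_toNNReal _).trans ?_)
    exact_mod_cast Finset.single_le_sum (f := fun i => (M i).toNNReal) (fun _ _ => zero_le)
      (Finset.mem_univ i)
  · exact mul_nonneg (Real.smoothTransition.nonneg _) (Real.smoothTransition.nonneg _)
  · exact mul_le_one₀ (Real.smoothTransition.le_one _) (Real.smoothTransition.nonneg _)
      (Real.smoothTransition.le_one _)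
  · have h3 : 1 ≤ 2 * V x / ε - 1 := by
      rw [le_sub_iff_add_le, le_div_iff₀ hε]; linarith
    have h4 : 1 ≤ 2 - V x / c := by
      have := (div_le_one hc).2 h2
      linarith
    simp [hg, hχ, Real.smoothTransition.one_of_one_le h3, Real.smoothTransition.one_of_one_le h4]

lemma IsTruncation.mono (hg : IsTruncation f V ε c g) {ε' : ℝ} (h : ε ≤ ε') :
    IsTruncation f V ε' c g :=
  ⟨hg.lipschitz, hg.bounded, hg.scale, fun i x h1 => hg.eq_of_mem i x (h.trans h1)⟩

/-- Carathéodory solutions of the truncated switched system. -/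
structure IsTruncatedSolution (g : Fin N → Vec n → Vec n) (σ : ℝ → Fin N) (t₀ : ℝ)
    (γ : ℝ → Vec n) : Prop where
  absCont : ∀ T, t₀ ≤ T → AbsolutelyContinuousOnInterval γ t₀ T
  deriv : ∀ᵐ t, t₀ ≤ t → HasDerivAt γ (g (σ t) (γ t)) t

lemma IsSwitchingSignal.aemeasurable {σ : ℝ → Fin N} (hσ : IsSwitchingSignal σ) {t₀ : ℝ}
    (ht₀ : 0 ≤ t₀) : AEMeasurable σ (volume.restrict (Set.Ici t₀)) := by
  set D : Set ℝ := {t | 0 ≤ t ∧ ¬ ContinuousAt σ t} with hD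
  have hDc : D.Countable := by
    have : D ⊆ ⋃ k : ℕ, {t : ℝ | 0 ≤ t ∧ t ≤ k ∧ ¬ ContinuousAt σ t} := by
      rintro t ⟨h0, ht⟩
      obtain ⟨k, hk⟩ := exists_nat_ge t
      exact Set.mem_iUnion.2 ⟨k, h0, hk, ht⟩
    exact (Set.countable_iUnion fun k : ℕ => (hσ k).countable).mono this
  have hcont : ContinuousOn σ (Set.Ici t₀ \ D) := fun t ht => by
    refine ContinuousAt.continuousWithinAt ?_
    by_contra hc
    exact ht.2 ⟨ht₀.trans ht.1, hc⟩
  have hae : Set.Ici t₀ =ᵐ[volume] (Set.Ici t₀ \ D : Set ℝ) :=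
    (sdiff_null_ae_eq_self (hDc.measure_zero _)).symm
  rw [Measure.restrict_congr_set hae]
  exact hcont.aemeasurable (measurableSet_Ici.diff hDc.measurableSet)

lemma IsTruncation.exists_solution (hg : IsTruncation f V ε c g) {σ : ℝ → Fin N} {t₀ : ℝ}
    (hσ : AEMeasurable σ (volume.restrict (Set.Ici t₀))) {M : NNReal} (hM : ∀ i x, ‖g i x‖ ≤ M)
    (x₀ : Vec n) :
    ∃ γ, LipschitzWith M γ ∧ (∀ t ≤ t₀, γ t = x₀) ∧ IsTruncatedSolution g σ t₀ γ := by
  obtain ⟨L, hL⟩ := hg.lipschitz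
  obtain ⟨γ, h1, h2, h3⟩ := exists_caratheodory_solution (g := fun t => g (σ t))
    (fun t => hL (σ t)) (fun t x => hM (σ t) x) (a := t₀) (fun x hx => by
      have hmeas : Measurable fun p : Fin N × Vec n => g p.1 p.2 :=
        measurable_from_prod_countable_right fun i => (hL i).continuous.measurable
      exact (hmeas.comp_aemeasurable
        (hσ.prodMk hx.measurable.aemeasurable)).aestronglyMeasurable) x₀
  exact ⟨γ, h1, h2, fun T _ => h1.lipschitzOnWith.absolutelyContinuousOnInterval, h3⟩

lemma IsTruncatedSolution.antitoneOn (hV : IsCommonLyapunov f V) (hg : IsTruncation f V ε c g)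
    {σ : ℝ → Fin N} {t₀ : ℝ} {γ : ℝ → Vec n} (hγ : IsTruncatedSolution g σ t₀ γ) :
    AntitoneOn (fun t => V (γ t)) (Set.Ici t₀) := by
  refine hV.antitoneOn hγ.absCont ?_
  filter_upwards [hγ.deriv] with t ht h0 hne
  refine ⟨_, ht h0, ?_⟩
  obtain ⟨θ, hθ, -, he, -⟩ := hg.scale (σ t) (γ t)
  rw [he, map_smul, smul_eq_mul]
  exact mul_nonpos_of_nonneg_of_nonpos hθ (hV.decay _ _ hne).le

/-- A curve that solves the original equation as long as `V ≥ ε` coincides with the truncated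
solution until both enter `V ≤ ε`, where both remain. -/
lemma IsTruncatedSolution.eq_or_le (hV : IsCommonLyapunov f V) (hg : IsTruncation f V ε c g)
    {σ : ℝ → Fin N} {t₀ : ℝ} {γ ξ : ℝ → Vec n} (hγ : IsTruncatedSolution g σ t₀ γ)
    (hξ : ∀ T, t₀ ≤ T → AbsolutelyContinuousOnInterval ξ t₀ T)
    (hξV : AntitoneOn (fun t => V (ξ t)) (Set.Ici t₀))
    (hξd : ∀ᵐ t, t₀ ≤ t → ε ≤ V (ξ t) → HasDerivAt ξ (f (σ t) (ξ t)) t)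
    (h0 : ξ t₀ = γ t₀) (hc : V (ξ t₀) ≤ c) {t : ℝ} (ht : t₀ ≤ t) :
    ξ t = γ t ∨ (V (ξ t) ≤ ε ∧ V (γ t) ≤ ε) := by
  have hγV := hγ.antitoneOn hV hg
  have hagree : ∀ s, t₀ ≤ s → ε ≤ V (ξ s) → ξ s = γ s := by
    intro s hs hle
    obtain ⟨L, hL⟩ := hg.lipschitz
    refine eqOn_of_ae_hasDerivAt_lipschitz (g := fun t => g (σ t)) (fun t => hL (σ t)) hs
      (hξ s hs) (hγ.absCont s hs) ?_ ?_ h0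
    · filter_upwards [hξd] with r hr hrm
      have h1 : ε ≤ V (ξ r) := hle.trans (hξV hrm.1.le hs hrm.2.le)
      have h2 : V (ξ r) ≤ c := (hξV Set.self_mem_Ici (show t₀ ≤ r from hrm.1.le) hrm.1.le).trans hc
      rw [hg.eq_of_mem _ _ h1 h2]
      exact hr hrm.1.le h1
    · filter_upwards [hγ.deriv] with r hr hrm using hr hrm.1.le
  rcases le_or_gt ε (V (ξ t)) with h | h
  · exact Or.inl (hagree t ht h)
  · refine Or.inr ⟨h.le, ?_⟩
    rcases le_or_gt (V (ξ t₀)) ε with h1 | h1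
    · refine (hγV Set.self_mem_Ici ht ht).trans ?_
      simpa only [← h0] using h1
    · have hcont : ContinuousOn (fun s => V (ξ s)) (Set.Icc t₀ t) :=
        (hV.cont.comp_continuousOn (absolutelyContinuous_continuousOn hξ)).mono
          fun r hr => hr.1
      obtain ⟨s, hs, hse⟩ := intermediate_value_Icc' ht hcont ⟨h.le, h1.le⟩
      have hse' : V (ξ s) = ε := hse
      refine (hγV hs.1 ht hs.2).trans ?_
      simp only [← hagree s hs.1 hse'.ge, hse', le_refl]

lemma IsTruncatedSolution.hasDerivAt_of_le (hg : IsTruncation f V ε c g) (hV : IsCommonLyapunov f V)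
    {σ : ℝ → Fin N} {t₀ : ℝ} {γ : ℝ → Vec n} (hγ : IsTruncatedSolution g σ t₀ γ)
    (hc : V (γ t₀) ≤ c) :
    ∀ᵐ t, t₀ ≤ t → ε ≤ V (γ t) → HasDerivAt γ (f (σ t) (γ t)) t := by
  filter_upwards [hγ.deriv] with t ht h0 hle
  rw [← hg.eq_of_mem _ _ hle ((hγ.antitoneOn hV hg Set.self_mem_Ici h0 h0).trans hc)]
  exact ht h0

/-- The solution is determined by the truncated solutions, which it follows down to arbitrarily low
levels of `V`. No growth condition on `f` at the origin is needed. -/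
lemma IsSolution.eq_of_eq (hV : IsCommonLyapunov f V) (hf : ∀ i, ContDiffOn ℝ 1 (f i) {0}ᶜ)
    {σ : ℝ → Fin N} (hσ : IsSwitchingSignal σ) {t₀ : ℝ} (ht₀ : 0 ≤ t₀) {x y : ℝ → Vec n}
    (hx : IsSolution f σ t₀ x) (hy : IsSolution f σ t₀ y) (h0 : x t₀ = y t₀) {t : ℝ}
    (ht : t₀ ≤ t) : x t = y t := by
  have hfc : ∀ i y, y ≠ 0 → ContinuousAt (f i) y := fun i y hy =>
    ((hf i).contDiffAt (isOpen_compl_singleton.mem_nhds hy)).continuousAt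
  -- Both solutions follow the truncated one down to a level where all three are within `η / 2` of
  -- the origin.
  refine eq_of_forall_dist_le fun η hη => ?_
  obtain ⟨ε, hε, hsmall⟩ := hV.exists_norm_le (half_pos hη)
  obtain ⟨g, hg⟩ := hV.exists_truncation hf hε
    (c := V (x t₀) + 1) (by have := hV.nonneg (x t₀); linarith)
  obtain ⟨M, hM⟩ := hg.bounded
  obtain ⟨γ, -, hγ0, hγ⟩ := hg.exists_solution (hσ.aemeasurable ht₀) hM (x t₀)
  have main : ∀ z, IsSolution f σ t₀ z → z t₀ = x t₀ →
      z t = γ t ∨ (V (z t) ≤ ε ∧ V (γ t) ≤ ε) := by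
    intro z hz hz0
    refine hγ.eq_or_le hV hg hz.absCont (hz.antitoneOn hfc hV) ?_
      (by rw [hz0, hγ0 t₀ le_rfl]) (by rw [hz0]; linarith) ht
    filter_upwards [hz.ae_hasDerivAt hfc] with s hs h1 h2
    exact hs h1 (hV.ne_zero (hε.trans_le h2))
  have key : ‖x t‖ ≤ η / 2 ∧ ‖y t‖ ≤ η / 2 ∨ x t = y t := by
    rcases main x hx rfl with h1 | ⟨h1, h1'⟩ <;> rcases main y hy h0.symm with h2 | ⟨h2, h2'⟩
    · exact Or.inr (h1.trans h2.symm)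
    · exact Or.inl ⟨hsmall _ (h1 ▸ h2'), hsmall _ h2⟩
    · exact Or.inl ⟨hsmall _ h1, hsmall _ (h2 ▸ h1')⟩
    · exact Or.inl ⟨hsmall _ h1, hsmall _ h2⟩
  rcases key with ⟨h1, h2⟩ | h
  · rw [dist_eq_norm]
    exact (norm_sub_le _ _).trans (by linarith)
  · rw [h, dist_self]; exact hη.le

/-- When `f` is bounded on the sublevel sets of `V`, the truncated solutions converge to a Filippov
solution as the inner radius of the shell shrinks to zero. -/
lemma exists_isSolution (hV : IsCommonLyapunov f V) (hf : ∀ i, ContDiffOn ℝ 1 (f i) {0}ᶜ)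
    (hb : ∀ c, ∃ M : NNReal, ∀ i x, V x ≤ c → ‖f i x‖ ≤ M) (h0 : ∀ i, 0 ∈ filippov (f i) 0)
    {σ : ℝ → Fin N} (hσ : IsSwitchingSignal σ) {t₀ : ℝ} (ht₀ : 0 ≤ t₀) (x₀ : Vec n) :
    ∃ x, IsSolution f σ t₀ x ∧ x t₀ = x₀ := by
  set c := V x₀ + 1 with hc
  have hc0 : 0 < c := by have := hV.nonneg x₀; linarith
  obtain ⟨M, hM⟩ := hb (2 * c)
  set e : ℕ → ℝ := fun k => 1 / ((k : ℝ) + 1) with he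
  have hepos : ∀ k, 0 < e k := fun k => by simp only [he]; positivity
  have hemono : ∀ {j k}, k ≤ j → e j ≤ e k := fun {j k} h => by
    simp only [he]
    have : (k : ℝ) ≤ j := by exact_mod_cast h
    gcongr
  have helim : Tendsto e atTop (𝓝 0) := tendsto_one_div_add_atTop_nhds_zero_nat
  choose g hg using fun k => hV.exists_truncation hf (hepos k) hc0
  have hgM : ∀ k i x, ‖g k i x‖ ≤ M := by
    intro k i x
    obtain ⟨θ, hθ0, hθ1, hθ, hθ2⟩ := (hg k).scale i x
    rw [hθ, norm_smul, Real.norm_of_nonneg hθ0]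
    rcases le_or_gt (V x) (2 * c) with h | h
    · exact (mul_le_of_le_one_left (norm_nonneg _) hθ1).trans (hM i x h)
    · rw [hθ2 h, zero_mul]; exact M.2
  choose γ hγL hγ0 hγ using fun k =>
    (hg k).exists_solution (hσ.aemeasurable ht₀) (hgM k) x₀
  have hVc : ∀ k, V (γ k t₀) ≤ c := fun k => by rw [hγ0 k t₀ le_rfl]; linarith
  have hshadow : ∀ k j, k ≤ j → ∀ t, t₀ ≤ t →
      γ j t = γ k t ∨ (V (γ j t) ≤ e k ∧ V (γ k t) ≤ e k) := by
    intro k j hkj t ht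
    exact (hγ k).eq_or_le hV (hg k) (hγ j).absCont ((hγ j).antitoneOn hV (hg j))
      (((hγ j).hasDerivAt_of_le ((hg j).mono (hemono hkj)) hV (hVc j)))
      (by rw [hγ0 j t₀ le_rfl, hγ0 k t₀ le_rfl]) (hVc j) ht
  have hconv : ∀ t, ∃ z, Tendsto (fun k => γ k t) atTop (𝓝 z) := by
    intro t
    rcases le_total t t₀ with ht | ht
    · exact ⟨x₀, by simp only [hγ0 _ t ht]; exact tendsto_const_nhds⟩
    · by_cases hk : ∃ k, e k < V (γ k t)
      · obtain ⟨k, hk⟩ := hk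
        refine ⟨γ k t, tendsto_const_nhds.congr' ?_⟩
        filter_upwards [eventually_ge_atTop k] with j hj
        exact ((hshadow k j hj t ht).resolve_right fun h => hk.not_ge h.2).symm
      · push Not at hk
        refine ⟨0, tendsto_zero_iff_norm_tendsto_zero.2 ?_⟩
        refine Metric.tendsto_nhds.2 fun η hη => ?_
        obtain ⟨δ, hδ, hsmall⟩ := hV.exists_norm_le (half_pos hη)
        filter_upwards [helim.eventually_lt_const hδ] with k hkδ
        rw [Real.dist_0_eq_abs, abs_of_nonneg (norm_nonneg _)]
        have := hsmall _ ((hk k).trans hkδ.le)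
        linarith
  choose x hx using hconv
  have hxL : LipschitzWith M x := LipschitzWith.of_dist_le_mul fun s t =>
    le_of_tendsto ((hx s).dist (hx t)) (Eventually.of_forall fun k => (hγL k).dist_le_mul s t)
  have hx0 : x t₀ = x₀ := tendsto_nhds_unique (hx t₀) (by
    simp only [hγ0 _ t₀ le_rfl]; exact tendsto_const_nhds)
  have hVx : ∀ t, Tendsto (fun k => V (γ k t)) atTop (𝓝 (V (x t))) := fun t =>
    (hV.cont.tendsto _).comp (hx t)
  have hanti : AntitoneOn (fun t => V (x t)) (Set.Ici t₀) := fun s hs t ht hst =>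
    le_of_tendsto_of_tendsto' (hVx t) (hVx s) fun k => (hγ k).antitoneOn hV (hg k) hs ht hst
  have heq : ∀ k t, t₀ ≤ t → e k < V (x t) → x t = γ k t := by
    intro k t ht hlt
    refine tendsto_nhds_unique (hx t) (tendsto_const_nhds.congr' ?_)
    filter_upwards [eventually_ge_atTop k, (hVx t).eventually_const_lt hlt] with j hj hjlt
    exact ((hshadow k j hj t ht).resolve_right fun h => hjlt.not_ge h.1).symm
  refine ⟨x, ⟨fun T _ => hxL.lipschitzOnWith.absolutelyContinuousOnInterval, ?_⟩, hx0⟩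
  refine (ae_restrict_iff' measurableSet_Ici).2 ?_
  have hne : ∀ᵐ t : ℝ, t ≠ t₀ := by simp [ae_iff]
  filter_upwards [hxL.ae_differentiableAt, ae_all_iff.2 fun k => (hγ k).deriv, hne]
    with t hdiff hder htne htm
  have ht : t₀ ≤ t := htm
  by_cases hxt : x t = 0
  · -- The curve rests at the origin from time `t` on, so its derivative there can only be `0`.
    refine ⟨0, by rw [hxt]; exact h0 (σ t), ?_⟩
    have hzero : ∀ s ∈ Set.Ici t, x s = x t := fun s hs => by
      rw [hxt]
      refine hV.eq_zero ((hanti ht (ht.trans hs) hs).trans ?_)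
      simp only [hxt, hV.zero, le_refl]
    have h1 : HasDerivWithinAt x (deriv x t) (Set.Ici t) t := hdiff.hasDerivAt.hasDerivWithinAt
    have h2 : HasDerivWithinAt x 0 (Set.Ici t) t :=
      (hasDerivWithinAt_const t (Set.Ici t) (x t)).congr hzero rfl
    have h3 := (uniqueDiffOn_Ici t t Set.self_mem_Ici).eq_deriv _ h1 h2
    rw [← h3]
    exact hdiff.hasDerivAt
  · have hpos := hV.pos _ hxt
    obtain ⟨k, hk⟩ := (helim.eventually_lt_const hpos).exists
    have hfc : ContinuousAt (f (σ t)) (x t) :=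
      ((hf _).contDiffAt (isOpen_compl_singleton.mem_nhds hxt)).continuousAt
    refine ⟨f (σ t) (x t), by rw [filippov_eq_singleton hfc]; rfl, ?_⟩
    have hle : V (x t) ≤ c := by
      have := hanti Set.self_mem_Ici ht ht
      simp only [hx0] at this
      linarith
    have h1 := hder k ht
    rw [← heq k t ht hk, (hg k).eq_of_mem _ _ hk.le hle] at h1
    refine h1.congr_of_eventuallyEq ?_
    have hVxc : Continuous fun s => V (x s) := hV.cont.comp hxL.continuous
    filter_upwards [hVxc.continuousAt.eventually_const_lt hk,
      Ioi_mem_nhds (lt_of_le_of_ne ht htne.symm)] with s hs hst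
    exact heq k s (le_of_lt hst) hs

lemma forwardComplete (hV : IsCommonLyapunov f V) (hf : ∀ i, ContDiffOn ℝ 1 (f i) {0}ᶜ)
    (hb : ∀ c, ∃ M : NNReal, ∀ i x, V x ≤ c → ‖f i x‖ ≤ M) (h0 : ∀ i, 0 ∈ filippov (f i) 0) :
    ForwardComplete f := fun _ hσ _ ht₀ x₀ =>
  ⟨exists_isSolution hV hf hb h0 hσ ht₀ x₀, fun _ _ hx hy hx0 hy0 _ ht =>
    hx.eq_of_eq hV hf hσ ht₀ hy (hx0.trans hy0.symm) ht⟩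

end Existence

/-! ### Stability from the decay of a Lyapunov function -/

section Stability

variable {n N : ℕ} {f : Fin N → Vec n → Vec n} {V : Vec n → ℝ} {ρ μ : ℝ}

/-- Uniform stability and boundedness follow from monotonicity of `V` along solutions; uniform
attractivity needs in addition a rate for the decay of `V`. -/
lemma IsCommonLyapunov.guas (hV : IsCommonLyapunov f V) (hf : ∀ i y, y ≠ 0 → ContinuousAt (f i) y)
    (hattr : ∀ C > 0, ∀ ε > 0, ∃ T > 0, ∀ σ, IsSwitchingSignal σ → ∀ t₀, 0 ≤ t₀ →
      ∀ x, IsSolution f σ t₀ x → V (x t₀) ≤ C → ∀ t, t₀ + T ≤ t → V (x t) ≤ ε) : GUAS f where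
  stable ε hε := by
    obtain ⟨c, hc, h1⟩ := hV.exists_norm_le hε
    obtain ⟨δ, hδ, h2⟩ := hV.exists_le_of_norm_le_pos hc
    exact ⟨δ, hδ, fun σ _ t₀ _ x hx h0 t ht =>
      h1 _ ((hx.antitoneOn hf hV Set.self_mem_Ici ht ht).trans (h2 _ h0))⟩
  bounded R _ := by
    obtain ⟨c, hc, h1⟩ := hV.exists_le_of_norm_le R
    obtain ⟨M, hM, h2⟩ := hV.exists_norm_le_of_le c
    exact ⟨M, hM, fun σ _ t₀ _ x hx h0 t ht =>
      h2 _ ((hx.antitoneOn hf hV Set.self_mem_Ici ht ht).trans (h1 _ h0))⟩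
  attractive R _ ε hε := by
    obtain ⟨C, hC, h1⟩ := hV.exists_le_of_norm_le R
    obtain ⟨c, hc, h2⟩ := hV.exists_norm_le hε
    obtain ⟨T, hT, h3⟩ := hattr C hC c hc
    exact ⟨T, hT, fun σ hσ t₀ ht₀ x hx h0 t ht => h2 _ (h3 σ hσ t₀ ht₀ x hx (h1 _ h0) t ht)⟩

lemma hasDerivAt_rpow_primitive (hμ : μ ≠ 0) {w : ℝ} (hw : 0 < w) :
    HasDerivAt (fun w : ℝ => w ^ (-μ) / (-μ)) (w ^ (-(1 + μ))) w := by
  refine ((Real.hasDerivAt_rpow_const (p := -μ) (Or.inl hw.ne')).div_const (-μ)).congr_deriv ?_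
  rw [mul_div_cancel_left₀ _ (neg_ne_zero.2 hμ)]
  congr 1; ring

variable (hV : IsCommonLyapunov f V) (hf : ∀ i y, y ≠ 0 → ContinuousAt (f i) y)
  (hdec : ∀ i y, y ≠ 0 → fderiv ℝ V y (f i y) ≤ -ρ * V y ^ (1 + μ)) (hρ : 0 < ρ)
  {σ : ℝ → Fin N} {t₀ : ℝ} {x : ℝ → Vec n} (hx : IsSolution f σ t₀ x)

include hV hf hdec hρ

include hx in
lemma IsSolution.eq_zero_of_neg (hμ : μ < 0) {t : ℝ}
    (ht : t₀ + V (x t₀) ^ (-μ) / (-μ * ρ) ≤ t) : x t = 0 := by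
  have hμ' : 0 < -μ := by linarith
  have h0 : 0 ≤ V (x t₀) ^ (-μ) / (-μ * ρ) :=
    div_nonneg (Real.rpow_nonneg (hV.nonneg _) _) (mul_pos hμ' hρ).le
  by_contra hne
  have h1 := hx.primitive_le hf hV hdec (fun w hw => hasDerivAt_rpow_primitive hμ.ne hw)
    (by linarith : t₀ ≤ t) hne
  have h2 : 0 < V (x t) ^ (-μ) / (-μ) := div_pos (Real.rpow_pos_of_pos (hV.pos _ hne) _) hμ'
  have h3 : V (x t₀) ^ (-μ) / (-μ) = ρ * (V (x t₀) ^ (-μ) / (-μ * ρ)) := by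
    field_simp
  have h4 : ρ * (V (x t₀) ^ (-μ) / (-μ * ρ)) ≤ ρ * (t - t₀) := by gcongr; linarith
  linarith

omit hρ in
include hx in
lemma IsSolution.le_exp_of_eq_zero (hμ : μ = 0) {t : ℝ} (ht : t₀ ≤ t) :
    V (x t) ≤ Real.exp (-ρ * (t - t₀)) * V (x t₀) := by
  rcases eq_or_ne (x t) 0 with h0 | hne
  · rw [h0, hV.zero]
    exact mul_nonneg (Real.exp_pos _).le (hV.nonneg _)
  · have h1 := hx.primitive_le hf hV hdec (H := Real.log) (fun w hw => by
      simpa [hμ, Real.rpow_neg_one] using Real.hasDerivAt_log hw.ne') ht hne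
    have hpos := hV.pos _ hne
    have hpos0 : 0 < V (x t₀) :=
      hpos.trans_le (hx.antitoneOn hf hV Set.self_mem_Ici ht ht)
    calc V (x t) = Real.exp (Real.log (V (x t))) := (Real.exp_log hpos).symm
      _ ≤ Real.exp (-ρ * (t - t₀) + Real.log (V (x t₀))) := Real.exp_le_exp.2 (by linarith)
      _ = _ := by rw [Real.exp_add, Real.exp_log hpos0]

include hx in
lemma IsSolution.le_of_pos (hμ : 0 < μ) {r : ℝ} (hr : 0 < r) {t : ℝ}
    (ht : t₀ + 1 / (μ * ρ * r ^ μ) ≤ t) : V (x t) ≤ r := by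
  have hrμ : 0 < r ^ μ := Real.rpow_pos_of_pos hr μ
  have h0 : 0 < 1 / (μ * ρ * r ^ μ) := by positivity
  rcases eq_or_ne (x t) 0 with h | hne
  · rw [h, hV.zero]; exact hr.le
  · by_contra! hlt
    have h1 := hx.primitive_le hf hV hdec (fun w hw => hasDerivAt_rpow_primitive hμ.ne' hw)
      (by linarith : t₀ ≤ t) hne
    have h2 : V (x t) ^ (-μ) < r ^ (-μ) := Real.rpow_lt_rpow_of_neg hr hlt (by linarith)
    have h3 : 0 ≤ V (x t₀) ^ (-μ) := Real.rpow_nonneg (hV.nonneg _) _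
    have h4 : r ^ (-μ) / μ = ρ * (1 / (μ * ρ * r ^ μ)) := by
      rw [Real.rpow_neg hr.le]; field_simp
    have h5 : ρ * (1 / (μ * ρ * r ^ μ)) ≤ ρ * (t - t₀) := by gcongr; linarith
    rw [div_neg, div_neg] at h1
    have h6 : V (x t) ^ (-μ) / μ < r ^ (-μ) / μ := by gcongr
    have h7 : 0 ≤ V (x t₀) ^ (-μ) / μ := by positivity
    linarith

lemma uniformlyFiniteTimeStable (hμ : μ < 0) : UniformlyFiniteTimeStable f := by
  have hμ' : 0 < -μ := by linarith
  have hT : ∀ C > 0, ∃ T > 0, ∀ σ, IsSwitchingSignal σ → ∀ t₀, 0 ≤ t₀ → ∀ x,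
      IsSolution f σ t₀ x → V (x t₀) ≤ C → ∀ t, t₀ + T ≤ t → x t = 0 := by
    intro C hC
    refine ⟨C ^ (-μ) / (-μ * ρ), by have := mul_pos hμ' hρ; positivity,
      fun σ _ t₀ _ x hx h0 t ht => hx.eq_zero_of_neg hV hf hdec hρ hμ ?_⟩
    refine le_trans ?_ ht
    have := hV.nonneg (x t₀)
    have := mul_pos hμ' hρ
    gcongr
  refine ⟨hV.guas hf fun C hC ε hε => ?_, fun R _ => ?_⟩
  · obtain ⟨T, hT0, h⟩ := hT C hC
    refine ⟨T, hT0, fun σ hσ t₀ ht₀ x hx h0 t ht => ?_⟩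
    rw [h σ hσ t₀ ht₀ x hx h0 t ht, hV.zero]
    exact hε.le
  · obtain ⟨C, hC, h1⟩ := hV.exists_le_of_norm_le R
    obtain ⟨T, hT0, h⟩ := hT C hC
    exact ⟨T, hT0, fun σ hσ t₀ ht₀ x hx h0 => h σ hσ t₀ ht₀ x hx (h1 _ h0)⟩

lemma uniformlyExponentiallyStable (hμ : μ = 0) {a b : ℝ} (ha : 0 < a) (hb : 0 < b)
    (hle : ∀ x, a * ‖x‖ ≤ V x) (hge : ∀ x, V x ≤ b * ‖x‖) : UniformlyExponentiallyStable f := by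
  refine ⟨b / a, by positivity, ρ, hρ, fun σ _ t₀ _ x hx t ht => ?_⟩
  have h1 := hx.le_exp_of_eq_zero hV hf hdec hμ ht
  have h2 := (hle (x t)).trans (h1.trans (mul_le_mul_of_nonneg_left (hge (x t₀))
    (Real.exp_pos _).le))
  rw [div_mul_eq_mul_div, div_mul_eq_mul_div, le_div_iff₀ ha]
  linarith

lemma uniformlyNearlyFixedTimeStable (hμ : 0 < μ) : UniformlyNearlyFixedTimeStable f := by
  refine ⟨hV.guas hf fun C _ ε hε => ?_, fun r hr => ?_⟩
  · have := Real.rpow_pos_of_pos hε μ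
    exact ⟨1 / (μ * ρ * ε ^ μ), by positivity, fun σ _ t₀ _ x hx _ t ht =>
      hx.le_of_pos hV hf hdec hρ hμ hε ht⟩
  · obtain ⟨c, hc, h⟩ := hV.exists_norm_le hr
    have := Real.rpow_pos_of_pos hc μ
    exact ⟨1 / (μ * ρ * c ^ μ), by positivity, fun σ _ t₀ _ x hx t ht =>
      h _ (hx.le_of_pos hV hf hdec hρ hμ hc ht)⟩

end Stability

/-! ### Homogeneity of the switched system -/

section Homogeneity

variable {n N : ℕ} {f : Fin N → Vec n → Vec n} {V : Vec n → ℝ} {d : ℝ → Mat n n} {μ : ℝ}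

lemma toEuclideanLin_mul_apply {k l p : ℕ} (M : Mat k l) (M' : Mat l p) (x : Vec p) :
    toEuclideanLin (M * M') x = toEuclideanLin M (toEuclideanLin M' x) := by
  simp [Matrix.toLpLin_apply, Matrix.mulVec_mulVec]

lemma toEuclideanLin_one_apply {k : ℕ} (x : Vec k) : toEuclideanLin (1 : Mat k k) x = x := by
  simp

lemma IsLinearDilation.neg_apply (hd : IsLinearDilation d) (s : ℝ) (x : Vec n) :
    toEuclideanLin (d s) (toEuclideanLin (d (-s)) x) = x := by
  rw [← toEuclideanLin_mul_apply, ← hd.add, add_neg_cancel, hd.zero, toEuclideanLin_one_apply]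

lemma IsLinearDilation.det_ne_zero (hd : IsLinearDilation d) (s : ℝ) :
    LinearMap.det (toEuclideanLin (d s)) ≠ 0 := by
  have h : toEuclideanLin (d s) * toEuclideanLin (d (-s)) = 1 :=
    LinearMap.ext fun x => hd.neg_apply s x
  have h2 := congrArg LinearMap.det h
  rw [map_mul, map_one] at h2
  exact left_ne_zero_of_mul_eq_one h2

lemma ae_comp_mul_left {P : ℝ → Prop} (hP : ∀ᵐ t, P t) {c : ℝ} (hc : c ≠ 0) :
    ∀ᵐ t, P (c * t) := by
  rw [ae_iff] at hP ⊢
  have h := Real.volume_preimage_mul_left hc {t | ¬ P t}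
  rw [hP, mul_zero] at h
  exact h

/-- Dilations in space and time map solutions to solutions, the signal being rescaled in time. -/
lemma IsSolution.dilate (hd : IsLinearDilation d) (hh : ∀ i, IsHomogeneousField d μ (f i))
    {σ : ℝ → Fin N} {x : ℝ → Vec n} (hx : IsSolution f σ 0 x) (s : ℝ) :
    IsSolution f (fun t => σ (Real.exp (μ * s) * t)) 0
      (fun t => toEuclideanLin (d s) (x (Real.exp (μ * s) * t))) := by
  set c := Real.exp (μ * s) with hc
  have hc0 : 0 < c := Real.exp_pos _
  set T : Vec n →L[ℝ] Vec n := LinearMap.toContinuousLinearMap (toEuclideanLin (d s)) with hT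
  refine ⟨fun b hb => ?_, ?_⟩
  · have h1 : AbsolutelyContinuousOnInterval (fun t => x (c * t)) 0 b :=
      absolutelyContinuousOnInterval_comp_mul hc0
        (by rw [mul_zero]; exact hx.absCont _ (by positivity))
    exact absolutelyContinuousOnInterval_comp_lipschitz T.lipschitz.lipschitzOnWith h1
  · refine (ae_restrict_iff' measurableSet_Ici).2 ?_
    filter_upwards [ae_comp_mul_left ((ae_restrict_iff' measurableSet_Ici).1 hx.inclusion)
      hc0.ne'] with t ht htm
    obtain ⟨v, hv, hder⟩ := ht (show (0 : ℝ) ≤ c * t from mul_nonneg hc0.le htm)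
    refine ⟨c • toEuclideanLin (d s) v,
      smul_mem_filippov_of_semiconj (hd.det_ne_zero s) (hh _ s) hv, ?_⟩
    have h1 : HasDerivAt (fun t : ℝ => c * t) c t := by
      simpa using (hasDerivAt_id t).const_mul c
    have h2 : HasDerivAt (fun t => x (c * t)) (c • v) t := hder.scomp t h1
    have h3 := T.hasFDerivAt.comp_hasDerivAt t h2
    rwa [map_smul] at h3

/-- Uniqueness for the rescaled signal reduces to that for `σ`, which holds for every `μ`. -/
lemma isHomogeneousSwitched (hd : IsLinearDilation d) (hh : ∀ i, IsHomogeneousField d μ (f i))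
    (hV : IsCommonLyapunov f V) (hf : ∀ i, ContDiffOn ℝ 1 (f i) {0}ᶜ) :
    IsHomogeneousSwitched d μ f := by
  intro s σ hσ x hx
  refine ⟨hx.dilate hd hh s, fun y hy h0 t ht => ?_⟩
  -- Dilating `y` back gives a second solution under `σ` with the initial state of `x`.
  have hexp : ∀ r : ℝ, Real.exp (μ * s) * (Real.exp (μ * -s) * r) = r := fun r => by
    rw [← mul_assoc, ← Real.exp_add]; simp
  have hexp' : ∀ r : ℝ, Real.exp (μ * -s) * (Real.exp (μ * s) * r) = r := fun r => by
    rw [← mul_assoc, ← Real.exp_add]; simp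
  have hy' := hy.dilate hd hh (-s)
  simp only [hexp] at hy'
  have h1 := hx.eq_of_eq hV hf hσ le_rfl hy' (t := Real.exp (μ * s) * t)
    (by
      have := hd.neg_apply (-s) (x 0)
      rw [neg_neg] at this
      simp only [mul_zero, h0, this])
    (by positivity)
  rw [h1, hexp', hd.neg_apply]

end Homogeneity

/-! ### Matrix exponentials and quadratic forms -/

section Exponential

variable {n m : ℕ}

lemma toEuclideanCLM_dil (G : Mat n n) (s : ℝ) : toEuclideanCLM (𝕜 := ℝ) (dil G s) =
    NormedSpace.exp (s • toEuclideanCLM (𝕜 := ℝ) G) := by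
  let _ : NormedRing (Mat n n) := Matrix.linftyOpNormedRing
  let _ : NormedAlgebra ℝ (Mat n n) := Matrix.linftyOpNormedAlgebra
  let _ : NormedAlgebra ℚ (Mat n n) := Matrix.linftyOpNormedAlgebra
  have hc : Continuous (toEuclideanCLM (n := Fin n) (𝕜 := ℝ)) :=
    LinearMap.continuous_of_finiteDimensional
      (toEuclideanCLM (n := Fin n) (𝕜 := ℝ)).toAlgEquiv.toLinearMap
  have h := NormedSpace.map_exp (toEuclideanCLM (n := Fin n) (𝕜 := ℝ)) hc (s • G)
  rw [map_smul] at h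
  rw [← h, dil]
  rfl

lemma dil_zero (G : Mat n n) : dil G 0 = 1 := by simp [dil]

lemma dil_add (G : Mat n n) (t s : ℝ) : dil G (t + s) = dil G t * dil G s := by
  rw [dil, add_smul]
  exact Matrix.exp_add_of_commute _ _ (((Commute.refl G).smul_left t).smul_right s)

lemma contDiff_dil (G : Mat n n) :
    ContDiff ℝ 1 fun s => toEuclideanCLM (𝕜 := ℝ) (dil G s) := by
  simp only [toEuclideanCLM_dil]
  refine contDiff_iff_contDiffAt.2 fun s => ?_
  exact ((NormedSpace.exp_analytic (𝕂 := ℝ) _).contDiffAt).comp s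
    (contDiffAt_id.smul contDiffAt_const)

lemma continuous_dil (G : Mat n n) : Continuous (dil G) := by
  have h1 : Continuous (toEuclideanCLM (n := Fin n) (𝕜 := ℝ)).symm :=
    LinearMap.continuous_of_finiteDimensional
      (toEuclideanCLM (n := Fin n) (𝕜 := ℝ)).symm.toAlgEquiv.toLinearMap
  have h2 := h1.comp (contDiff_dil G).continuous
  refine h2.congr fun s => ?_
  simp

lemma hasDerivAt_dil_apply (G : Mat n n) (x : Vec n) (s : ℝ) :
    HasDerivAt (fun s => toEuclideanLin (dil G s) x)
      (toEuclideanLin G (toEuclideanLin (dil G s) x)) s := by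
  have h1 := hasDerivAt_exp_smul_const' (𝕂 := ℝ) (toEuclideanCLM (n := Fin n) (𝕜 := ℝ) G) s
  simp only [← toEuclideanCLM_dil] at h1
  exact h1.clm_apply (hasDerivAt_const s x) |>.congr_deriv (by simp; rfl)

lemma dil_neg_apply (G : Mat n n) (s : ℝ) (x : Vec n) :
    toEuclideanLin (dil G (-s)) (toEuclideanLin (dil G s) x) = x := by
  rw [← toEuclideanLin_mul_apply, ← dil_add, neg_add_cancel, dil_zero, toEuclideanLin_one_apply]

lemma dil_apply_neg (G : Mat n n) (s : ℝ) (x : Vec n) :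
    toEuclideanLin (dil G s) (toEuclideanLin (dil G (-s)) x) = x := by
  simpa using dil_neg_apply G (-s) x

/-- The flow of `G` commutes with `G`. -/
lemma dil_apply_comm (G : Mat n n) (s : ℝ) (x : Vec n) :
    toEuclideanLin G (toEuclideanLin (dil G s) x) =
      toEuclideanLin (dil G s) (toEuclideanLin G x) := by
  rw [← toEuclideanLin_mul_apply, ← toEuclideanLin_mul_apply]
  congr 2
  have h : Commute G (s • G) := (Commute.refl G).smul_right s
  exact (show Commute G (dil G s) from by
    let _ : NormedRing (Mat n n) := Matrix.linftyOpNormedRing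
    let _ : NormedAlgebra ℝ (Mat n n) := Matrix.linftyOpNormedAlgebra
    let _ : NormedAlgebra ℚ (Mat n n) := Matrix.linftyOpNormedAlgebra
    exact h.exp_right)

/-- If `G C = C S + c C`, then `d(s)` intertwines accordingly: the curve
`e^{-c s} exp(-s G) C exp(s S) v` is constant. -/
lemma dil_intertwine {G : Mat n n} {S : Mat m m} {C : Mat n m} {c : ℝ}
    (h : G * C = C * S + c • C) (s : ℝ) (v : Vec m) :
    toEuclideanLin (dil G s) (toEuclideanLin C v) =
      Real.exp (c * s) • toEuclideanLin C (toEuclideanLin (dil S s) v) := by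
  set y : ℝ → Vec n := fun s =>
    Real.exp (c * s) • toEuclideanLin C (toEuclideanLin (dil S s) v) with hy
  have hyd : ∀ s, HasDerivAt y (toEuclideanLin G (y s)) s := by
    intro s
    have h1 : HasDerivAt (fun s => Real.exp (c * s)) (Real.exp (c * s) * c) s := by
      have : HasDerivAt (fun s : ℝ => c * s) c s := by simpa using (hasDerivAt_id s).const_mul c
      exact this.exp
    have h2 := (LinearMap.toContinuousLinearMap (toEuclideanLin C)).hasFDerivAt.comp_hasDerivAt s
      (hasDerivAt_dil_apply S v s)
    refine (h1.smul h2).congr_deriv ?_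
    simp only [hy, map_smul, ← toEuclideanLin_mul_apply G C, h, map_add, LinearMap.add_apply,
      LinearMap.smul_apply, toEuclideanLin_mul_apply, LinearMap.coe_toContinuousLinearMap',
      Function.comp_apply]
    module
  set w : ℝ → Vec n := fun s => toEuclideanLin (dil G (-s)) (y s) with hw
  have hwd : ∀ s, HasDerivAt w 0 s := by
    intro s
    have h1 := hasDerivAt_exp_smul_const' (𝕂 := ℝ) (toEuclideanCLM (n := Fin n) (𝕜 := ℝ) G) (-s)
    simp only [← toEuclideanCLM_dil] at h1
    have h2 := h1.scomp s (hasDerivAt_neg s)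
    refine (h2.clm_apply (hyd s)).congr_deriv ?_
    change ((-1 : ℝ) • (toEuclideanCLM (𝕜 := ℝ) G * toEuclideanCLM (𝕜 := ℝ) (dil G (-s)))) (y s) +
      toEuclideanLin (dil G (-s)) (toEuclideanLin G (y s)) = 0
    rw [← dil_apply_comm]
    simp only [_root_.smul_apply, neg_smul, one_smul]
    exact neg_add_cancel _
  have hconst := is_const_of_deriv_eq_zero (fun s => (hwd s).differentiableAt)
    (fun s => (hwd s).deriv) s 0
  simp only [hw, hy, neg_zero, dil_zero, toEuclideanLin_one_apply, mul_zero, Real.exp_zero,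
    one_smul] at hconst
  rw [← hconst, dil_apply_neg]

end Exponential

section QuadraticForm

variable {n m : ℕ}

lemma dotProduct_mulVec_eq_inner (M : Mat m n) (x : Vec m) (y : Vec n) :
    x.ofLp ⬝ᵥ (M *ᵥ y.ofLp) = inner ℝ x (toEuclideanLin M y) := by
  rw [EuclideanSpace.inner_eq_star_dotProduct, dotProduct_comm]
  simp

lemma inner_toEuclideanLin_eq (M : Mat m n) (x : Vec m) (y : Vec n) :
    inner ℝ x (toEuclideanLin M y) = inner ℝ (toEuclideanLin Mᵀ x) y := by
  rw [← Matrix.conjTranspose_eq_transpose_of_trivial,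
    Matrix.toEuclideanLin_conjTranspose_eq_adjoint, LinearMap.adjoint_inner_left]

/-- The quadratic form `xᵀ M x`. -/
noncomputable def quad (M : Mat n n) (x : Vec n) : ℝ := inner ℝ x (toEuclideanLin M x)

lemma wnorm_eq (P : Mat n n) (x : Vec n) : wnorm P x = Real.sqrt (quad P x) := by
  rw [wnorm, dotProduct_mulVec_eq_inner, quad]

lemma quad_smul (M : Mat n n) (c : ℝ) (x : Vec n) : quad M (c • x) = c ^ 2 * quad M x := by
  simp only [quad, map_smul, inner_smul_left, inner_smul_right]
  simp; ring

lemma quad_zero (M : Mat n n) : quad M 0 = 0 := by simp [quad]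

lemma continuous_quad (M : Mat n n) : Continuous (quad M) := by
  have h : Continuous (toEuclideanLin M) := LinearMap.continuous_of_finiteDimensional _
  exact continuous_id.inner h

lemma quad_pos {M : Mat n n} (hM : M.PosDef) {x : Vec n} (hx : x ≠ 0) : 0 < quad M x := by
  rw [quad, ← dotProduct_mulVec_eq_inner]
  have := (Matrix.posDef_iff_dotProduct_mulVec.1 hM).2 (x := x.ofLp) (by simpa using hx)
  simpa using this

lemma quad_nonneg {M : Mat n n} (hM : M.PosSemidef) (x : Vec n) : 0 ≤ quad M x := by
  rw [quad, ← dotProduct_mulVec_eq_inner]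
  simpa using hM.dotProduct_mulVec_nonneg x.ofLp

lemma exists_le_quad {M : Mat n n} (hM : M.PosDef) : ∃ a > 0, ∀ x, a * ‖x‖ ^ 2 ≤ quad M x := by
  rcases (Metric.sphere (0 : Vec n) 1).eq_empty_or_nonempty with he | hne
  · refine ⟨1, one_pos, fun x => ?_⟩
    have hx : x = 0 := by
      by_contra hx
      refine (Set.eq_empty_iff_forall_notMem.1 he (‖x‖⁻¹ • x)) ?_
      simp [norm_smul, inv_mul_cancel₀ (norm_ne_zero_iff.2 hx)]
    simp [hx, quad_zero]
  · obtain ⟨y, hy, hmin⟩ := (isCompact_sphere (0 : Vec n) 1).exists_isMinOn hne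
      (continuous_quad M).continuousOn
    have hy0 : y ≠ 0 := by
      rintro rfl
      simp at hy
    refine ⟨quad M y, quad_pos hM hy0, fun x => ?_⟩
    rcases eq_or_ne x 0 with rfl | hx
    · simp [quad_zero]
    · have hx' := norm_ne_zero_iff.2 hx
      have h1 : quad M y ≤ quad M (‖x‖⁻¹ • x) :=
        hmin (by simp [norm_smul, inv_mul_cancel₀ hx'])
      rw [quad_smul] at h1
      calc quad M y * ‖x‖ ^ 2 ≤ (‖x‖⁻¹ ^ 2 * quad M x) * ‖x‖ ^ 2 := by gcongr
        _ = quad M x := by field_simp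

lemma exists_quad_le (M : Mat n n) : ∃ b > 0, ∀ x, quad M x ≤ b * ‖x‖ ^ 2 := by
  set T := LinearMap.toContinuousLinearMap (toEuclideanLin M)
  refine ⟨‖T‖ + 1, by positivity, fun x => ?_⟩
  calc quad M x ≤ ‖x‖ * ‖T x‖ := real_inner_le_norm x (T x)
    _ ≤ ‖x‖ * (‖T‖ * ‖x‖) := by gcongr; exact T.le_opNorm x
    _ ≤ (‖T‖ + 1) * ‖x‖ ^ 2 := by nlinarith [sq_nonneg ‖x‖]

lemma quad_add_transpose (M : Mat n n) (x : Vec n) : quad (M + Mᵀ) x = 2 * quad M x := by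
  simp only [quad, map_add, LinearMap.add_apply, inner_add_right]
  rw [inner_toEuclideanLin_eq Mᵀ, Matrix.transpose_transpose, real_inner_comm]
  ring

/-- Derivative of `xᵀ P x` along a curve, for symmetric `P`. -/
lemma hasDerivAt_quad {P : Mat n n} (hP : Pᵀ = P) {y : ℝ → Vec n} {y' : Vec n} {s : ℝ}
    (hy : HasDerivAt y y' s) :
    HasDerivAt (fun s => quad P (y s)) (2 * inner ℝ (y s) (toEuclideanLin P y')) s := by
  have h1 := (LinearMap.toContinuousLinearMap (toEuclideanLin P)).hasFDerivAt.comp_hasDerivAt s hy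
  refine (hy.inner ℝ h1).congr_deriv ?_
  have h2 : inner ℝ y' (toEuclideanLin P (y s)) = inner ℝ (y s) (toEuclideanLin P y') := by
    rw [inner_toEuclideanLin_eq P y', hP, real_inner_comm]
  simp only [LinearMap.coe_toContinuousLinearMap', Function.comp_apply]
  rw [h2]; ring

end QuadraticForm

/-! ### The canonical homogeneous norm -/

section HomNorm

variable {n : ℕ} {G P : Mat n n}

lemma dil_apply_ne_zero (G : Mat n n) (s : ℝ) {x : Vec n} (hx : x ≠ 0) :
    toEuclideanLin (dil G s) x ≠ 0 := fun h => hx (by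
  rw [← dil_neg_apply G s x, h, map_zero])

lemma transpose_eq_of_posDef (hP : P.PosDef) : Pᵀ = P := by
  rw [← Matrix.conjTranspose_eq_transpose_of_trivial]
  exact hP.isHermitian

lemma hasDerivAt_quad_dil (hP : P.PosDef) (x : Vec n) (s : ℝ) :
    HasDerivAt (fun s => quad P (toEuclideanLin (dil G s) x))
      (2 * quad (P * G) (toEuclideanLin (dil G s) x)) s := by
  refine (hasDerivAt_quad (transpose_eq_of_posDef hP) (hasDerivAt_dil_apply G x s)).congr_deriv ?_
  rw [quad, toEuclideanLin_mul_apply]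

variable (hP : P.PosDef) (hQ : (P * G + (P * G)ᵀ).PosDef)

include hQ in
lemma quad_mul_pos {x : Vec n} (hx : x ≠ 0) : 0 < quad (P * G) x := by
  have := quad_pos hQ hx
  rw [quad_add_transpose] at this
  linarith

include hP hQ

/-- The dilation expands the norm `√(xᵀ P x)` at an exponential rate. -/
lemma exists_quad_dil_growth : ∃ a > 0, ∀ (x : Vec n) (s t : ℝ), s ≤ t →
    Real.exp (a * (t - s)) * quad P (toEuclideanLin (dil G s) x) ≤
      quad P (toEuclideanLin (dil G t) x) := by
  obtain ⟨a, ha, hle⟩ := exists_le_quad hQ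
  obtain ⟨b, hb, hge⟩ := exists_quad_le P
  refine ⟨a / b, by positivity, fun x => ?_⟩
  have hrate : ∀ y, a / b * quad P y ≤ 2 * quad (P * G) y := fun y => by
    have h1 := hle y
    rw [quad_add_transpose] at h1
    calc a / b * quad P y ≤ a / b * (b * ‖y‖ ^ 2) := by gcongr; exact hge y
      _ = a * ‖y‖ ^ 2 := by field_simp
      _ ≤ _ := h1
  set w : ℝ → ℝ := fun s => Real.exp (-(a / b * s)) * quad P (toEuclideanLin (dil G s) x) with hw
  have hwd : ∀ s, HasDerivAt w (Real.exp (-(a / b * s)) *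
      (2 * quad (P * G) (toEuclideanLin (dil G s) x) -
        a / b * quad P (toEuclideanLin (dil G s) x))) s := by
    intro s
    have h1 : HasDerivAt (fun s : ℝ => -(a / b * s)) (-(a / b)) s :=
      ((hasDerivAt_id s).const_mul (a / b)).neg.congr_deriv (by simp)
    refine (h1.exp.mul (hasDerivAt_quad_dil hP x s)).congr_deriv ?_
    ring
  have hmono : Monotone w := monotone_of_deriv_nonneg (fun s => (hwd s).differentiableAt)
    fun s => by
      rw [(hwd s).deriv]
      exact mul_nonneg (Real.exp_pos _).le (sub_nonneg.2 (hrate _))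
  intro s t hst
  have h1 := mul_le_mul_of_nonneg_left (hmono hst) (Real.exp_pos (a / b * t)).le
  simp only [hw, ← mul_assoc, ← Real.exp_add] at h1
  rw [add_neg_cancel, Real.exp_zero, one_mul] at h1
  rwa [show a / b * t + -(a / b * s) = a / b * (t - s) by ring] at h1

lemma strictMono_quad_dil {x : Vec n} (hx : x ≠ 0) :
    StrictMono fun s => quad P (toEuclideanLin (dil G s) x) :=
  strictMono_of_hasDerivAt_pos (hasDerivAt_quad_dil hP x) fun s =>
    mul_pos two_pos (quad_mul_pos hQ (dil_apply_ne_zero G s hx))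

lemma tendsto_quad_dil_atTop {x : Vec n} (hx : x ≠ 0) :
    Tendsto (fun s => quad P (toEuclideanLin (dil G s) x)) atTop atTop := by
  obtain ⟨a, ha, h⟩ := exists_quad_dil_growth hP hQ
  have h1 : Tendsto (fun s => Real.exp (a * (s - 0)) * quad P (toEuclideanLin (dil G 0) x)) atTop
      atTop := by
    refine Tendsto.atTop_mul_const (quad_pos hP (dil_apply_ne_zero G 0 hx))
      (Real.tendsto_exp_atTop.comp ?_)
    simpa using tendsto_id.const_mul_atTop ha
  exact tendsto_atTop_mono' _ (by
    filter_upwards [eventually_ge_atTop 0] with s hs using h x 0 s hs) h1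

lemma tendsto_quad_dil_atBot (x : Vec n) :
    Tendsto (fun s => quad P (toEuclideanLin (dil G s) x)) atBot (𝓝 0) := by
  obtain ⟨a, ha, h⟩ := exists_quad_dil_growth hP hQ
  have h1 : Tendsto (fun s => Real.exp (a * s) * quad P (toEuclideanLin (dil G 0) x)) atBot
      (𝓝 (0 * quad P (toEuclideanLin (dil G 0) x))) :=
    (Real.tendsto_exp_atBot.comp (tendsto_id.const_mul_atBot ha)).mul_const _
  rw [zero_mul] at h1
  refine tendsto_of_tendsto_of_tendsto_of_le_of_le' tendsto_const_nhds h1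
    (Eventually.of_forall fun s => quad_nonneg hP.posSemidef _) ?_
  filter_upwards [eventually_le_atBot 0] with s hs
  have h2 := mul_le_mul_of_nonneg_left (h x s 0 hs) (Real.exp_pos (a * s)).le
  rwa [← mul_assoc, ← Real.exp_add, zero_sub, mul_neg, add_neg_cancel, Real.exp_zero,
    one_mul] at h2

lemma isLinearDilation_dil : IsLinearDilation (dil G) := by
  obtain ⟨a, ha, hle⟩ := exists_le_quad hP
  obtain ⟨b, hb, hge⟩ := exists_quad_le P
  refine ⟨dil_zero G, dil_add G, continuous_dil G, fun x _ => ?_, fun x hx => ?_⟩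
  · have h1 : Tendsto (fun s => Real.sqrt (quad P (toEuclideanLin (dil G s) x) / a)) atBot
        (𝓝 (Real.sqrt (0 / a))) :=
      (Real.continuous_sqrt.tendsto _).comp ((tendsto_quad_dil_atBot hP hQ x).div_const a)
    rw [zero_div, Real.sqrt_zero] at h1
    refine squeeze_zero (fun s => norm_nonneg _) (fun s => Real.le_sqrt_of_sq_le ?_) h1
    rw [le_div_iff₀ ha, mul_comm]
    exact hle _
  · have hx0 : x ≠ 0 := by rintro rfl; simp at hx
    have h1 : Tendsto (fun s => Real.sqrt (quad P (toEuclideanLin (dil G s) x) / b)) atTop atTop :=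
      Real.tendsto_sqrt_atTop.comp ((tendsto_quad_dil_atTop hP hQ hx0).atTop_div_const hb)
    refine tendsto_atTop_mono (fun s => ?_) h1
    rw [← Real.sqrt_sq (norm_nonneg (toEuclideanLin (dil G s) x))]
    refine Real.sqrt_le_sqrt ?_
    rw [div_le_iff₀ hb, mul_comm]
    exact hge _

lemma existsUnique_quad_dil {x : Vec n} (hx : x ≠ 0) :
    ∃! s : ℝ, quad P (toEuclideanLin (dil G (-s)) x) = 1 := by
  have hcont : Continuous fun s => quad P (toEuclideanLin (dil G s) x) :=
    continuous_iff_continuousAt.2 fun s => (hasDerivAt_quad_dil hP x s).continuousAt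
  obtain ⟨r, hr⟩ := mem_range_of_exists_le_of_exists_ge hcont
    ((tendsto_quad_dil_atBot hP hQ x).eventually_le_const one_pos).exists
    ((tendsto_quad_dil_atTop hP hQ hx).eventually_ge_atTop 1).exists
  refine ⟨-r, by simpa using hr, fun s hs => ?_⟩
  have : -s = r := (strictMono_quad_dil hP hQ hx).injective (hs.trans hr.symm)
  rw [← this, neg_neg]

omit hP hQ in
lemma wnorm_eq_one_iff (P : Mat n n) (x : Vec n) : wnorm P x = 1 ↔ quad P x = 1 := by
  rw [wnorm_eq, Real.sqrt_eq_one]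

lemma homNorm_eq_exp {x : Vec n} {s : ℝ} (hs : quad P (toEuclideanLin (dil G (-s)) x) = 1) :
    homNorm G P x = Real.exp s := by
  have hx : x ≠ 0 := by
    rintro rfl
    simp [quad_zero] at hs
  have hex : ∃ s : ℝ, wnorm P (toEuclideanLin (dil G (-s)) x) = 1 :=
    ⟨s, (wnorm_eq_one_iff _ _).2 hs⟩
  rw [homNorm, dif_pos hex]
  congr 1
  exact (existsUnique_quad_dil hP hQ hx).unique ((wnorm_eq_one_iff _ _).1 hex.choose_spec) hs

omit hP hQ in
lemma homNorm_zero (G P : Mat n n) : homNorm G P 0 = 0 := by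
  rw [homNorm, dif_neg]
  rintro ⟨s, hs⟩
  simp [wnorm_eq_one_iff, quad_zero] at hs

lemma homNorm_pos {x : Vec n} (hx : x ≠ 0) : 0 < homNorm G P x := by
  obtain ⟨s, hs, -⟩ := existsUnique_quad_dil hP hQ hx
  rw [homNorm_eq_exp hP hQ hs]
  exact Real.exp_pos s

lemma homNorm_nonneg (x : Vec n) : 0 ≤ homNorm G P x := by
  rcases eq_or_ne x 0 with rfl | hx
  · exact (homNorm_zero G P).ge
  · exact (homNorm_pos hP hQ hx).le

/-- The homogeneous projection `d(-ln ‖x‖_d) x` lies on the unit sphere. -/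
lemma quad_dil_log_homNorm {x : Vec n} (hx : x ≠ 0) :
    quad P (toEuclideanLin (dil G (-Real.log (homNorm G P x))) x) = 1 := by
  obtain ⟨s, hs, -⟩ := existsUnique_quad_dil hP hQ hx
  rwa [homNorm_eq_exp hP hQ hs, Real.log_exp]

lemma homNorm_dil (s : ℝ) (x : Vec n) :
    homNorm G P (toEuclideanLin (dil G s) x) = Real.exp s * homNorm G P x := by
  rcases eq_or_ne x 0 with rfl | hx
  · simp [homNorm_zero]
  · obtain ⟨r, hr, -⟩ := existsUnique_quad_dil hP hQ hx
    rw [homNorm_eq_exp hP hQ hr, ← Real.exp_add]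
    refine homNorm_eq_exp hP hQ ?_
    rw [← toEuclideanLin_mul_apply, ← dil_add]
    simpa using hr

lemma homNorm_neg (x : Vec n) : homNorm G P (-x) = homNorm G P x := by
  rcases eq_or_ne x 0 with rfl | hx
  · simp
  · obtain ⟨r, hr, -⟩ := existsUnique_quad_dil hP hQ hx
    rw [homNorm_eq_exp hP hQ hr]
    refine homNorm_eq_exp hP hQ ?_
    rw [map_neg, ← neg_one_smul ℝ, quad_smul, hr]
    norm_num

lemma homNorm_le_exp_iff (x : Vec n) (r : ℝ) :
    homNorm G P x ≤ Real.exp r ↔ quad P (toEuclideanLin (dil G (-r)) x) ≤ 1 := by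
  rcases eq_or_ne x 0 with rfl | hx
  · simp [homNorm_zero, quad_zero, Real.exp_nonneg]
  · obtain ⟨s, hs, -⟩ := existsUnique_quad_dil hP hQ hx
    rw [homNorm_eq_exp hP hQ hs, Real.exp_le_exp, ← hs,
      (strictMono_quad_dil hP hQ hx).le_iff_le, neg_le_neg_iff]

/-- Sublevel sets of the homogeneous norm are ellipsoids. -/
lemma isCompact_homNorm_le (c : ℝ) : IsCompact {x | homNorm G P x ≤ Real.exp c} := by
  simp only [homNorm_le_exp_iff hP hQ]
  have hT : Continuous (toEuclideanLin (dil G (-c))) := LinearMap.continuous_of_finiteDimensional _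
  have hT' : Continuous (toEuclideanLin (dil G c)) := LinearMap.continuous_of_finiteDimensional _
  obtain ⟨a, ha, hle⟩ := exists_le_quad hP
  have hK : IsCompact (toEuclideanLin (dil G c) '' Metric.closedBall 0 (Real.sqrt (1 / a))) :=
    (isCompact_closedBall _ _).image hT'
  refine hK.of_isClosed_subset
    (isClosed_le ((continuous_quad P).comp hT) continuous_const) fun x hx => ?_
  refine ⟨toEuclideanLin (dil G (-c)) x, ?_, dil_apply_neg G c x⟩
  rw [mem_closedBall_zero_iff]
  refine Real.le_sqrt_of_sq_le ?_
  rw [le_div_iff₀ ha, mul_comm]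
  exact (hle _).trans hx

lemma tendsto_homNorm_cocompact : Tendsto (homNorm G P) (cocompact (Vec n)) atTop := by
  refine tendsto_atTop.2 fun b => ?_
  have h := (isCompact_homNorm_le hP hQ (Real.log (max b 1))).compl_mem_cocompact
  filter_upwards [h] with x hx
  have h1 : ¬ homNorm G P x ≤ Real.exp (Real.log (max b 1)) := hx
  rw [Real.exp_log (by positivity), not_le] at h1
  exact (le_max_left b 1).trans h1.le

/-- Continuity at the origin: `‖x‖_d ≤ e^r` holds on the neighbourhood `‖d(-r) x‖_P ≤ 1`. -/
lemma continuousAt_homNorm_zero : ContinuousAt (homNorm G P) 0 := by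
  rw [ContinuousAt, homNorm_zero]
  refine Metric.tendsto_nhds.2 fun ε hε => ?_
  have hT : Continuous (toEuclideanLin (dil G (-Real.log (ε / 2)))) :=
    LinearMap.continuous_of_finiteDimensional _
  have hev : ∀ᶠ x in 𝓝 (0 : Vec n), quad P (toEuclideanLin (dil G (-Real.log (ε / 2))) x) < 1 :=
    ((continuous_quad P).comp hT).continuousAt.eventually_lt continuousAt_const
      (by simp [quad_zero])
  filter_upwards [hev] with x hx
  have h1 := (homNorm_le_exp_iff hP hQ x _).2 hx.le
  rw [Real.exp_log (by positivity)] at h1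
  rw [Real.dist_0_eq_abs, abs_of_nonneg (homNorm_nonneg hP hQ x)]
  linarith

omit hP hQ in
lemma contDiff_quad_dil (G P : Mat n n) : ContDiff ℝ 1 fun p : Vec n × ℝ =>
    quad P (toEuclideanLin (dil G (-p.2)) p.1) := by
  have h1 : ContDiff ℝ 1 fun p : Vec n × ℝ => toEuclideanCLM (𝕜 := ℝ) (dil G (-p.2)) p.1 :=
    ((contDiff_dil G).comp contDiff_snd.neg).clm_apply contDiff_fst
  exact h1.inner ℝ ((toEuclideanCLM (𝕜 := ℝ) P).contDiff.comp h1)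

omit hQ in
/-- Partial derivatives of `(x, s) ↦ ‖d(-s) x‖_P ^ 2`. -/
lemma fderiv_quad_dil_apply (x : Vec n) (s : ℝ) (h : Vec n) (η : ℝ) :
    fderiv ℝ (fun p : Vec n × ℝ => quad P (toEuclideanLin (dil G (-p.2)) p.1)) (x, s) (h, η) =
      2 * inner ℝ (toEuclideanLin (dil G (-s)) x)
        (toEuclideanLin P (toEuclideanLin (dil G (-s)) h)) -
      η * (2 * quad (P * G) (toEuclideanLin (dil G (-s)) x)) := by
  set F : Vec n × ℝ → ℝ := fun p => quad P (toEuclideanLin (dil G (-p.2)) p.1) with hF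
  have hFd : HasFDerivAt F (fderiv ℝ F (x, s)) (x, s) :=
    ((contDiff_quad_dil G P).differentiable one_ne_zero).differentiableAt.hasFDerivAt
  have h1 : fderiv ℝ F (x, s) (h, 0) = 2 * inner ℝ (toEuclideanLin (dil G (-s)) x)
      (toEuclideanLin P (toEuclideanLin (dil G (-s)) h)) := by
    have hl : HasDerivAt (fun t : ℝ => (x + t • h, s)) (h, 0) 0 := by
      refine HasDerivAt.prodMk ?_ (hasDerivAt_const _ _)
      simpa using ((hasDerivAt_id (0 : ℝ)).smul_const h).const_add x
    have hFd' : HasFDerivAt F (fderiv ℝ F (x, s)) (x + (0 : ℝ) • h, s) := by simpa using hFd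
    have hc := hFd'.comp_hasDerivAt (0 : ℝ) hl
    have hy : HasDerivAt (fun t : ℝ => toEuclideanLin (dil G (-s)) (x + t • h))
        (toEuclideanLin (dil G (-s)) h) 0 := by
      simp only [map_add, map_smul]
      simpa using ((hasDerivAt_id (0 : ℝ)).smul_const (toEuclideanLin (dil G (-s)) h)).const_add
        (toEuclideanLin (dil G (-s)) x)
    have hq := hasDerivAt_quad (transpose_eq_of_posDef hP) hy
    simp only [zero_smul, add_zero] at hq
    exact hc.unique hq
  have h2 : fderiv ℝ F (x, s) (0, 1) = -(2 * quad (P * G) (toEuclideanLin (dil G (-s)) x)) := by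
    have hl : HasDerivAt (fun t : ℝ => (x, t)) ((0 : Vec n), (1 : ℝ)) s :=
      (hasDerivAt_const _ _).prodMk (hasDerivAt_id s)
    have hc := hFd.comp_hasDerivAt s hl
    have hq := (hasDerivAt_quad_dil (G := G) hP x (-s)).comp s (hasDerivAt_neg s)
    rw [mul_neg_one] at hq
    exact hc.unique hq
  have hsplit : ((h, η) : Vec n × ℝ) = (h, 0) + η • ((0 : Vec n), (1 : ℝ)) := by simp
  rw [hsplit, map_add, map_smul, h1, h2, smul_eq_mul]
  ring

/-- The homogeneous norm is `C¹` off the origin, by the implicit function theorem. -/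
lemma contDiffAt_homNorm {x : Vec n} (hx : x ≠ 0) : ContDiffAt ℝ 1 (homNorm G P) x := by
  set F : Vec n × ℝ → ℝ := fun p => quad P (toEuclideanLin (dil G (-p.2)) p.1) with hF
  set s := Real.log (homNorm G P x) with hs
  have hFx : F (x, s) = 1 := quad_dil_log_homNorm hP hQ hx
  have hcd : ContDiffAt ℝ 1 F (x, s) := (contDiff_quad_dil G P).contDiffAt
  have hinv : (fderiv ℝ F (x, s) ∘L .inr ℝ (Vec n) ℝ).IsInvertible := by
    set k := -(2 * quad (P * G) (toEuclideanLin (dil G (-s)) x)) with hk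
    have hk0 : k ≠ 0 := by
      have := quad_mul_pos hQ (dil_apply_ne_zero G (-s) hx)
      rw [hk]; linarith
    refine ⟨ContinuousLinearEquiv.unitsEquivAut ℝ (Units.mk0 k hk0), ?_⟩
    ext
    simp [hF, fderiv_quad_dil_apply hP, hk]
  have hψ := hcd.contDiffAt_implicitFunction one_ne_zero hinv
  have hev := hcd.eventually_apply_implicitFunction one_ne_zero hinv
  refine (Real.contDiff_exp.contDiffAt.comp x hψ).congr_of_eventuallyEq ?_
  filter_upwards [hev] with y hy
  exact homNorm_eq_exp hP hQ (hy.trans hFx)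

lemma continuous_homNorm : Continuous (homNorm G P) := by
  refine continuous_iff_continuousAt.2 fun x => ?_
  rcases eq_or_ne x 0 with rfl | hx
  · exact continuousAt_homNorm_zero hP hQ
  · exact (contDiffAt_homNorm hP hQ hx).continuousAt

/-- The derivative of the homogeneous norm, from `‖d(-ln ‖x‖_d) x‖_P = 1`. -/
lemma fderiv_homNorm_apply {x : Vec n} (hx : x ≠ 0) (h : Vec n) :
    fderiv ℝ (homNorm G P) x h * quad (P * G)
        (toEuclideanLin (dil G (-Real.log (homNorm G P x))) x) =
      homNorm G P x * inner ℝ (toEuclideanLin (dil G (-Real.log (homNorm G P x))) x)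
        (toEuclideanLin P (toEuclideanLin (dil G (-Real.log (homNorm G P x))) h)) := by
  set F : Vec n × ℝ → ℝ := fun p => quad P (toEuclideanLin (dil G (-p.2)) p.1) with hF
  have hVpos := homNorm_pos hP hQ hx
  have hV : HasFDerivAt (homNorm G P) (fderiv ℝ (homNorm G P) x) x :=
    ((contDiffAt_homNorm hP hQ hx).differentiableAt one_ne_zero).hasFDerivAt
  have hlog := hV.log hVpos.ne'
  have hFd : HasFDerivAt F (fderiv ℝ F (x, Real.log (homNorm G P x)))
      (x, Real.log (homNorm G P x)) :=
    ((contDiff_quad_dil G P).differentiable one_ne_zero).differentiableAt.hasFDerivAt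
  have hcomp := hFd.comp x ((hasFDerivAt_id x).prodMk hlog)
  have hone : HasFDerivAt (F ∘ fun y => (id y, Real.log (homNorm G P y)))
      (0 : Vec n →L[ℝ] ℝ) x := by
    refine (hasFDerivAt_const (1 : ℝ) x).congr_of_eventuallyEq ?_
    filter_upwards [isOpen_compl_singleton.mem_nhds hx] with y hy
    exact quad_dil_log_homNorm hP hQ hy
  have heq := congrArg (fun L : Vec n →L[ℝ] ℝ => L h) (hcomp.unique hone)
  have heq' : fderiv ℝ F (x, Real.log (homNorm G P x))
      (h, (homNorm G P x)⁻¹ * fderiv ℝ (homNorm G P) x h) = 0 := by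
    simpa using heq
  rw [hF, fderiv_quad_dil_apply hP] at heq'
  field_simp at heq'
  linarith

end HomNorm

/-! ### The linear matrix inequalities -/

section LMI

variable {n m : ℕ} {X G : Mat n n}

lemma inv_conj_symm {X : Mat n n} (hX : X.PosDef) (M : Mat n n) :
    X⁻¹ * (M * X + X * Mᵀ) * X⁻¹ = X⁻¹ * M + (X⁻¹ * M)ᵀ := by
  have hu : IsUnit X.det := (Matrix.isUnit_iff_isUnit_det _).1 hX.isUnit
  rw [Matrix.transpose_mul, transpose_eq_of_posDef hX.inv, Matrix.mul_add, Matrix.add_mul,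
    Matrix.mul_assoc, Matrix.mul_assoc M, Matrix.mul_nonsing_inv _ hu, Matrix.mul_one,
    ← Matrix.mul_assoc X⁻¹ X, Matrix.nonsing_inv_mul _ hu, Matrix.one_mul]

lemma posDef_inv_mul_add_transpose (hX : X.PosDef) (hGX : (G * X + X * Gᵀ).PosDef) :
    (X⁻¹ * G + (X⁻¹ * G)ᵀ).PosDef := by
  rw [← inv_conj_symm hX]
  have h := hGX.conjTranspose_mul_mul_same (B := X⁻¹)
    (Matrix.mulVec_injective_iff_isUnit.2 hX.inv.isUnit)
  rwa [hX.inv.isHermitian.eq] at h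

/-- The matrix inequality for `X`, `Y` as a dissipation inequality for `P = X⁻¹`, `K = Y X⁻¹`. -/
lemma quad_closedLoop_le (hX : X.PosDef) {A₀ : Mat n n} {B : Mat n m} {Y : Mat m n} {ρ : ℝ}
    (hLMI : (-(X * A₀ᵀ + A₀ * X + B * Y + Yᵀ * Bᵀ + ρ • (G * X + X * Gᵀ))).PosSemidef)
    (y : Vec n) :
    quad (X⁻¹ * (A₀ + B * (Y * X⁻¹))) y ≤ -ρ * quad (X⁻¹ * G) y := by
  have hu : IsUnit X.det := (Matrix.isUnit_iff_isUnit_det _).1 hX.isUnit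
  set M : Mat n n := A₀ + B * (Y * X⁻¹) + ρ • G with hM
  have hM' : X * A₀ᵀ + A₀ * X + B * Y + Yᵀ * Bᵀ + ρ • (G * X + X * Gᵀ) = M * X + X * Mᵀ := by
    have h1 : B * (Y * X⁻¹) * X = B * Y := by
      rw [Matrix.mul_assoc, Matrix.mul_assoc, Matrix.nonsing_inv_mul _ hu, Matrix.mul_one]
    have h2 : X * (B * (Y * X⁻¹))ᵀ = Yᵀ * Bᵀ := by
      rw [Matrix.transpose_mul, Matrix.transpose_mul, transpose_eq_of_posDef hX.inv,
        ← Matrix.mul_assoc, ← Matrix.mul_assoc, Matrix.mul_nonsing_inv _ hu, Matrix.one_mul]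
    rw [hM, Matrix.add_mul, Matrix.add_mul, h1, Matrix.transpose_add, Matrix.transpose_add,
      Matrix.mul_add, Matrix.mul_add, h2, Matrix.transpose_smul, Matrix.smul_mul, Matrix.mul_smul]
    module
  rw [hM'] at hLMI
  have h := hLMI.conjTranspose_mul_mul_same X⁻¹
  rw [hX.inv.isHermitian.eq, Matrix.mul_neg, Matrix.neg_mul, inv_conj_symm hX] at h
  have h1 := quad_nonneg h y
  have h2 : ∀ N : Mat n n, quad (-N) y = -quad N y := fun N => by simp [quad]
  rw [h2, quad_add_transpose] at h1
  have h3 : quad (X⁻¹ * M) y =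
      quad (X⁻¹ * (A₀ + B * (Y * X⁻¹))) y + ρ * quad (X⁻¹ * G) y := by
    rw [hM, Matrix.mul_add X⁻¹ _ (ρ • G), Matrix.mul_smul]
    simp [quad, inner_add_right, inner_smul_right]
  linarith

open scoped MatrixOrder in
/-- Rayleigh bound for the largest eigenvalue. -/
lemma quad_le_lambdaMax {M : Mat n n} (hM : M.PosSemidef) (w : Vec n) :
    quad M w ≤ lambdaMax M * ‖w‖ ^ 2 := by
  have hle : M ≤ algebraMap ℝ (Mat n n) (lambdaMax M) := by
    refine le_algebraMap_of_spectrum_le (fun r hr => ?_) (ha := hM.isHermitian)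
    exact le_csSup (Matrix.finite_real_spectrum (A := M)).bddAbove hr
  have h1 := quad_nonneg (Matrix.le_iff.1 hle) w
  rw [Algebra.algebraMap_eq_smul_one] at h1
  simp only [quad, map_sub, map_smul, LinearMap.sub_apply, LinearMap.smul_apply,
    toEuclideanLin_one_apply, inner_sub_right, inner_smul_right,
    real_inner_self_eq_norm_sq] at h1
  rw [quad]; linarith

open scoped MatrixOrder in
/-- On the unit sphere `zᵀ X⁻¹ z = 1` write `z = X^{1/2} w` with `‖w‖ = 1`. -/
lemma norm_le_gainBound (hX : X.PosDef) (K : Mat m n) {z : Vec n} (hz : quad X⁻¹ z = 1) :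
    ‖toEuclideanLin K z‖ ≤ gainBound X K := by
  have hu : IsUnit X.det := (Matrix.isUnit_iff_isUnit_det _).1 hX.isUnit
  set S := CFC.sqrt X with hS
  have hSS : S * S = X := CFC.sqrt_mul_sqrt_self X (Matrix.nonneg_iff_posSemidef.2 hX.posSemidef)
  have hSt : Sᵀ = S := by
    rw [← Matrix.conjTranspose_eq_transpose_of_trivial]
    exact (Matrix.nonneg_iff_posSemidef.1 (CFC.sqrt_nonneg X)).isHermitian
  set w := toEuclideanLin (S * X⁻¹) z with hw
  have hSw : toEuclideanLin S w = z := by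
    rw [hw, ← toEuclideanLin_mul_apply, ← Matrix.mul_assoc, hSS, Matrix.mul_nonsing_inv _ hu,
      toEuclideanLin_one_apply]
  have hnorm : ‖w‖ ^ 2 = 1 := by
    have h := inner_toEuclideanLin_eq (S * X⁻¹)ᵀ z w
    rw [Matrix.transpose_transpose, ← hw] at h
    rw [← real_inner_self_eq_norm_sq, ← h, hw, ← hz, quad, ← toEuclideanLin_mul_apply]
    congr 3
    rw [Matrix.transpose_mul, hSt, transpose_eq_of_posDef hX.inv,
      Matrix.mul_assoc, ← Matrix.mul_assoc S S, hSS, Matrix.mul_nonsing_inv _ hu, Matrix.mul_one]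
  have hM : (S * Kᵀ * K * S).PosSemidef := by
    have h1 := Matrix.posSemidef_conjTranspose_mul_self (K * S)
    rw [Matrix.conjTranspose_eq_transpose_of_trivial, Matrix.transpose_mul, hSt] at h1
    simpa only [Matrix.mul_assoc] using h1
  have hq : ‖toEuclideanLin K z‖ ^ 2 = quad (S * Kᵀ * K * S) w := by
    rw [← real_inner_self_eq_norm_sq, quad, Matrix.mul_assoc (S * Kᵀ),
      toEuclideanLin_mul_apply (S * Kᵀ), inner_toEuclideanLin_eq (S * Kᵀ), Matrix.transpose_mul,
      Matrix.transpose_transpose, hSt, toEuclideanLin_mul_apply K, hSw]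
  rw [gainBound]
  refine Real.le_sqrt_of_sq_le ?_
  rw [hq]
  simpa [hnorm] using quad_le_lambdaMax hM w

end LMI

/-! ### The closed-loop fields -/

section ClosedLoop

variable {n m : ℕ} {G P A₀ C : Mat n n} {μ ρ : ℝ}

/-- The homogeneous field `A₀ x + ‖x‖_d ^ (1 + μ) C d(-ln ‖x‖_d) x`. -/
noncomputable def homField (G P : Mat n n) (μ : ℝ) (A₀ C : Mat n n) (x : Vec n) : Vec n :=
  toEuclideanLin A₀ x + (homNorm G P x ^ (1 + μ)) •
    toEuclideanLin C (toEuclideanLin (dil G (-Real.log (homNorm G P x))) x)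

lemma modeField_feedback (A : Mat n n) (B : Mat n m) (K₀ K : Mat m n) :
    modeField A B (feedback G P μ K₀ K) = homField G P μ (A + B * K₀) (B * K) := by
  funext x
  simp only [modeField, feedback, homField, map_add, map_smul, LinearMap.add_apply,
    toEuclideanLin_mul_apply, add_assoc]

lemma homField_zero (G P : Mat n n) (μ : ℝ) (A₀ C : Mat n n) : homField G P μ A₀ C 0 = 0 := by
  simp [homField]

lemma dil_apply_of_mul_eq (hC : G * C = C) (s : ℝ) (x : Vec n) :
    toEuclideanLin (dil G s) (toEuclideanLin C x) = Real.exp s • toEuclideanLin C x := by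
  have h := dil_intertwine (G := G) (S := (0 : Mat n n)) (C := C) (c := 1) (by simp [hC]) s x
  have h0 : dil (0 : Mat n n) s = 1 := by simp [dil]
  rwa [one_mul, h0, toEuclideanLin_one_apply] at h

lemma dil_apply_of_commute (hA : A₀ * G = (G + μ • (1 : Mat n n)) * A₀) (s : ℝ) (x : Vec n) :
    toEuclideanLin (dil G s) (toEuclideanLin A₀ x) =
      Real.exp (-μ * s) • toEuclideanLin A₀ (toEuclideanLin (dil G s) x) := by
  refine dil_intertwine ?_ s x
  rw [hA, Matrix.add_mul, Matrix.smul_mul, Matrix.one_mul]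
  module

section

variable (hP : P.PosDef) (hQ : (P * G + (P * G)ᵀ).PosDef)

include hP hQ

/-- Oddness of the field, which makes the origin a Filippov equilibrium for every `μ`. -/
lemma homField_neg (x : Vec n) : homField G P μ A₀ C (-x) = -homField G P μ A₀ C x := by
  simp only [homField, homNorm_neg hP hQ, map_neg, smul_neg, neg_add]

lemma isHomogeneousField_homField (hA : A₀ * G = (G + μ • (1 : Mat n n)) * A₀) (hC : G * C = C) :
    IsHomogeneousField (dil G) μ (homField G P μ A₀ C) := by
  intro s x
  rcases eq_or_ne x 0 with rfl | hx
  · simp [homField_zero]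
  · have hV := homNorm_pos hP hQ hx
    have hz : toEuclideanLin (dil G (-Real.log (Real.exp s * homNorm G P x)))
        (toEuclideanLin (dil G s) x) =
        toEuclideanLin (dil G (-Real.log (homNorm G P x))) x := by
      rw [← toEuclideanLin_mul_apply, ← dil_add, Real.log_mul (Real.exp_pos s).ne' hV.ne',
        Real.log_exp]
      congr 3; ring
    rw [homField, homNorm_dil hP hQ, hz, homField, map_add, map_smul, dil_apply_of_mul_eq hC,
      dil_apply_of_commute hA, smul_add, smul_smul, smul_smul, smul_smul, ← Real.exp_add,
      Real.mul_rpow (Real.exp_pos s).le hV.le, ← Real.exp_mul]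
    congr 1
    · simp
    · congr 1
      rw [mul_add, mul_one, Real.exp_add, mul_comm s μ]; ring

/-- Pulled back to the unit sphere, the field is `V ^ μ` times the linear field `A₀ + C`. -/
lemma dil_homField (hA : A₀ * G = (G + μ • (1 : Mat n n)) * A₀) (hC : G * C = C) {x : Vec n}
    (hx : x ≠ 0) :
    toEuclideanLin (dil G (-Real.log (homNorm G P x))) (homField G P μ A₀ C x) =
      homNorm G P x ^ μ • toEuclideanLin (A₀ + C)
        (toEuclideanLin (dil G (-Real.log (homNorm G P x))) x) := by
  have hV := homNorm_pos hP hQ hx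
  rw [homField, map_add, map_smul, dil_apply_of_mul_eq hC, dil_apply_of_commute hA, map_add,
    LinearMap.add_apply, smul_add, smul_smul]
  congr 2
  · rw [neg_mul_neg, mul_comm, Real.rpow_def_of_pos hV]
  · rw [Real.rpow_add hV, Real.rpow_one, Real.exp_neg, Real.exp_log hV]
    field_simp

lemma fderiv_homNorm_homField_le (hA : A₀ * G = (G + μ • (1 : Mat n n)) * A₀) (hC : G * C = C)
    (hLMI : ∀ y, quad (P * (A₀ + C)) y ≤ -ρ * quad (P * G) y) {x : Vec n} (hx : x ≠ 0) :
    fderiv ℝ (homNorm G P) x (homField G P μ A₀ C x) ≤ -ρ * homNorm G P x ^ (1 + μ) := by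
  have hV := homNorm_pos hP hQ hx
  have h := fderiv_homNorm_apply hP hQ hx (homField G P μ A₀ C x)
  rw [dil_homField hP hQ hA hC hx] at h
  set z := toEuclideanLin (dil G (-Real.log (homNorm G P x))) x with hz
  have hzq : 0 < quad (P * G) z := quad_mul_pos hQ (dil_apply_ne_zero G _ hx)
  have hpow : homNorm G P x ^ (1 + μ) = homNorm G P x * homNorm G P x ^ μ := by
    rw [Real.rpow_add hV, Real.rpow_one]
  rw [map_smul, inner_smul_right, ← toEuclideanLin_mul_apply, ← quad, ← mul_assoc,
    ← hpow] at h
  refine le_of_mul_le_mul_right ?_ hzq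
  rw [h]
  calc homNorm G P x ^ (1 + μ) * quad (P * (A₀ + C)) z
      ≤ homNorm G P x ^ (1 + μ) * (-ρ * quad (P * G) z) := by
        gcongr; exact hLMI z
    _ = _ := by ring

lemma contDiffOn_homField : ContDiffOn ℝ 1 (homField G P μ A₀ C) {0}ᶜ := by
  intro x hx
  have hV := contDiffAt_homNorm hP hQ hx
  have hpos := homNorm_pos hP hQ hx
  have h1 : ContDiffAt ℝ 1 (fun y => homNorm G P y ^ (1 + μ)) x := hV.rpow_const_of_ne hpos.ne'
  have h2 : ContDiffAt ℝ 1 (fun y => -Real.log (homNorm G P y)) x := (hV.log hpos.ne').neg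
  have h3 : ContDiffAt ℝ 1
      (fun y => toEuclideanCLM (𝕜 := ℝ) (dil G (-Real.log (homNorm G P y))) y) x :=
    ((contDiff_dil G).contDiffAt.comp x h2).clm_apply contDiffAt_id
  have h4 : ContDiffAt ℝ 1 (fun y => toEuclideanCLM (𝕜 := ℝ) C
      (toEuclideanCLM (𝕜 := ℝ) (dil G (-Real.log (homNorm G P y))) y)) x :=
    (toEuclideanCLM (𝕜 := ℝ) C).contDiff.contDiffAt.comp x h3
  have h5 : ContDiffAt ℝ 1 (fun y => toEuclideanCLM (𝕜 := ℝ) A₀ y) x :=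
    (toEuclideanCLM (𝕜 := ℝ) A₀).contDiff.contDiffAt
  exact (h5.add (h1.smul h4)).contDiffWithinAt

/-- For `μ ≥ -1` the factor `V ^ (1 + μ)` does not blow up at the origin. -/
lemma exists_norm_homField_le (hμ : -1 ≤ μ) (c : ℝ) :
    ∃ M : NNReal, ∀ x, homNorm G P x ≤ c → ‖homField G P μ A₀ C x‖ ≤ M := by
  obtain ⟨a, ha, hle⟩ := exists_le_quad hP
  obtain ⟨R, hR0, hR⟩ :=
    (isCompact_homNorm_le hP hQ (Real.log (max c 1))).isBounded.exists_pos_norm_le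
  set TA := toEuclideanCLM (𝕜 := ℝ) A₀
  set TC := toEuclideanCLM (𝕜 := ℝ) C
  refine ⟨(‖TA‖ * R + max c 1 ^ (1 + μ) * (‖TC‖ * Real.sqrt (1 / a))).toNNReal,
    fun x hx => le_trans ?_ (Real.le_coe_toNNReal _)⟩
  have hc1 : homNorm G P x ≤ max c 1 := hx.trans (le_max_left _ _)
  have hxR : ‖x‖ ≤ R := hR x (by
    change homNorm G P x ≤ Real.exp (Real.log (max c 1))
    rwa [Real.exp_log (by positivity)])
  have hz : ‖toEuclideanLin (dil G (-Real.log (homNorm G P x))) x‖ ≤ Real.sqrt (1 / a) := by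
    rcases eq_or_ne x 0 with rfl | hx0
    · simp
    · refine Real.le_sqrt_of_sq_le ?_
      rw [le_div_iff₀ ha, mul_comm, ← quad_dil_log_homNorm hP hQ hx0]
      exact hle _
  have hVn := homNorm_nonneg hP hQ x
  rw [homField]
  refine (norm_add_le _ _).trans (add_le_add ?_ ?_)
  · exact (TA.le_opNorm x).trans (by gcongr)
  · rw [norm_smul, Real.norm_of_nonneg (Real.rpow_nonneg hVn _)]
    have h1 : homNorm G P x ^ (1 + μ) ≤ max c 1 ^ (1 + μ) :=
      Real.rpow_le_rpow hVn hc1 (by linarith)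
    have h2 := TC.le_opNorm (toEuclideanLin (dil G (-Real.log (homNorm G P x))) x)
    have h3 := h2.trans (mul_le_mul_of_nonneg_left hz (norm_nonneg _))
    exact mul_le_mul h1 h3 (norm_nonneg _) (by positivity)

/-- For `G = 1` the homogeneous norm is the norm `√(xᵀ P x)`. -/
lemma exists_homNorm_equiv_norm (hG : G = 1) :
    ∃ a > 0, ∃ b > 0, (∀ x, a * ‖x‖ ≤ homNorm G P x) ∧ ∀ x, homNorm G P x ≤ b * ‖x‖ := by
  obtain ⟨a, ha, hle⟩ := exists_le_quad hP
  obtain ⟨b, hb, hge⟩ := exists_quad_le P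
  have hsq : ∀ x, homNorm G P x ^ 2 = quad P x := by
    intro x
    rcases eq_or_ne x 0 with rfl | hx
    · simp [homNorm_zero, quad_zero]
    · have hV := homNorm_pos hP hQ hx
      have h := dil_apply_of_mul_eq (G := G) (C := 1) (by simp [hG])
        (-Real.log (homNorm G P x)) x
      have h1 := quad_dil_log_homNorm hP hQ hx
      rw [toEuclideanLin_one_apply] at h
      rw [h, quad_smul, Real.exp_neg, Real.exp_log hV] at h1
      field_simp at h1
      exact h1.symm
  refine ⟨Real.sqrt a, Real.sqrt_pos.2 ha, Real.sqrt b, Real.sqrt_pos.2 hb, fun x => ?_,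
    fun x => ?_⟩
  · refine (sq_le_sq₀ (by positivity) (homNorm_nonneg hP hQ x)).1 ?_
    rw [mul_pow, Real.sq_sqrt ha.le, hsq]
    exact hle x
  · refine (sq_le_sq₀ (homNorm_nonneg hP hQ x) (by positivity)).1 ?_
    rw [mul_pow, Real.sq_sqrt hb.le, hsq]
    exact hge x

end

end ClosedLoop

end SwitchedHom

theorem mainTheorem1 (n m N : ℕ) (hN : 0 < N)
    (A : Fin N → Mat n n) (B : Fin N → Mat n m)
    (hctrl : ∀ i, Controllable (A i) (B i))
    (G₀ : Mat n n) (Y₀ : Fin N → Mat m n)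
    (hG₀ : ∀ i, A i * G₀ - G₀ * A i + B i * Y₀ i = A i)
    (hG₀B : ∀ i, G₀ * B i = 0) :
    (∃ ε > 0, ∀ μ : ℝ, |μ| < ε → AntiHurwitz (1 + μ • G₀)) ∧
    IsUnit (G₀ - 1) ∧
    ∀ (K₀ : Fin N → Mat m n) (A₀ : Fin N → Mat n n),
      (∀ i, K₀ i = Y₀ i * (G₀ - 1)⁻¹) → (∀ i, A₀ i = A i + B i * K₀ i) →
    ∀ (μ : ℝ) (G : Mat n n), G = 1 + μ • G₀ →
      (∀ i, A₀ i * G = (G + μ • (1 : Mat n n)) * A₀ i ∧ G * B i = B i) ∧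
      ∀ (X : Mat n n) (Y : Fin N → Mat m n) (ρ : ℝ), 0 < ρ →
        (∀ i, (-(X * (A₀ i)ᵀ + A₀ i * X + B i * Y i + (Y i)ᵀ * (B i)ᵀ
          + ρ • (G * X + X * Gᵀ))).PosSemidef) →
        (G * X + X * Gᵀ).PosDef → X.PosDef →
      ∀ (K : Fin N → Mat m n) (V : Vec n → ℝ) (u : Fin N → Vec n → Vec m)
        (f : Fin N → Vec n → Vec n),
        (∀ i, K i = Y i * X⁻¹) → V = homNorm G X⁻¹ →
        (∀ i, u i = feedback G X⁻¹ μ (K₀ i) (K i)) →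
        (∀ i, f i = modeField (A i) (B i) (u i)) →
        -- the dilation and the canonical homogeneous norm are well defined
        (IsLinearDilation (dil G) ∧
          ∀ x : Vec n, x ≠ 0 → ∃! s : ℝ, wnorm X⁻¹ (toEuclideanLin (dil G (-s)) x) = 1) ∧
        -- common Lyapunov function, with its decay along modes and along solutions
        IsCommonLyapunov f V ∧
        (∀ i x, x ≠ 0 → fderiv ℝ V x (f i x) ≤ -ρ * V x ^ (1 + μ)) ∧
        (∀ σ, IsSwitchingSignal σ → ∀ t₀, 0 ≤ t₀ → ∀ x, IsSolution f σ t₀ x →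
          ∀ᵐ t ∂(volume.restrict (Set.Ici t₀)), x t ≠ 0 →
            ∃ v, HasDerivAt (fun τ => V (x τ)) v t ∧ v ≤ -ρ * V (x t) ^ (1 + μ)) ∧
        -- control bound
        (∀ i x, x ≠ 0 →
          ‖u i x‖ ≤ ‖toEuclideanLin (K₀ i) x‖ + gainBound X (K i) * V x ^ (1 + μ)) ∧
        -- homogeneity of the closed loop
        (∀ i, IsHomogeneousField (dil G) μ (f i)) ∧
        IsHomogeneousSwitched (dil G) μ f ∧
        -- existence and uniqueness of solutions
        (-1 ≤ μ → ForwardComplete f) ∧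
        -- stability under arbitrary switching, with the settling-time estimates
        (-1 ≤ μ → μ < 0 → UniformlyFiniteTimeStable f ∧
          ∀ σ, IsSwitchingSignal σ → ∀ t₀, 0 ≤ t₀ → ∀ x, IsSolution f σ t₀ x →
            ∀ t, t₀ + V (x t₀) ^ (-μ) / (-μ * ρ) ≤ t → x t = 0) ∧
        (μ = 0 → UniformlyExponentiallyStable f ∧
          ∀ σ, IsSwitchingSignal σ → ∀ t₀, 0 ≤ t₀ → ∀ x, IsSolution f σ t₀ x →
            ∀ t, t₀ ≤ t → V (x t) ≤ Real.exp (-ρ * (t - t₀)) * V (x t₀)) ∧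
        (0 < μ → UniformlyNearlyFixedTimeStable f ∧
          ∀ σ, IsSwitchingSignal σ → ∀ t₀, 0 ≤ t₀ → ∀ x, IsSolution f σ t₀ x →
            ∀ r, 0 < r → ∀ t, t₀ + 1 / (μ * ρ * r ^ μ) ≤ t → V (x t) ≤ r) := by
  refine ⟨exists_antiHurwitz G₀, isUnit_sub_one (hctrl ⟨0, hN⟩) (hG₀ _) (hG₀B _), ?_⟩
  have hU : IsUnit (G₀ - 1) := isUnit_sub_one (hctrl ⟨0, hN⟩) (hG₀ _) (hG₀B _)
  intro K₀ A₀ hK₀ hA₀ μ G hG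
  have hcomm : ∀ i, A₀ i * G = (G + μ • (1 : Mat n n)) * A₀ i ∧ G * B i = B i := by
    intro i
    rw [hA₀, hK₀, hG]
    exact ⟨homogenized_commute hU (hG₀ i) (hG₀B i) μ, by
      rw [Matrix.add_mul, Matrix.smul_mul, hG₀B, Matrix.one_mul, smul_zero, add_zero]⟩
  refine ⟨hcomm, fun X Y ρ hρ hLMI hGX hX K V u f hK hVdef hu hf => ?_⟩
  have hP : (X⁻¹).PosDef := hX.inv
  have hQ : (X⁻¹ * G + (X⁻¹ * G)ᵀ).PosDef := posDef_inv_mul_add_transpose hX hGX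
  have hC : ∀ i, G * (B i * K i) = B i * K i := fun i => by
    rw [← Matrix.mul_assoc, (hcomm i).2]
  have hf' : ∀ i, f i = homField G X⁻¹ μ (A₀ i) (B i * K i) := fun i => by
    rw [hf, hu, modeField_feedback, hA₀]
  have hdec : ∀ i x, x ≠ 0 → fderiv ℝ V x (f i x) ≤ -ρ * V x ^ (1 + μ) := by
    intro i x hx
    rw [hVdef, hf']
    refine fderiv_homNorm_homField_le hP hQ (hcomm i).1 (hC i) (fun y => ?_) hx
    rw [hK]
    exact quad_closedLoop_le hX (hLMI i) y
  have hsmooth : ∀ i, ContDiffOn ℝ 1 (f i) {0}ᶜ := fun i => by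
    rw [hf']; exact contDiffOn_homField hP hQ
  have hcont : ∀ i y, y ≠ 0 → ContinuousAt (f i) y := fun i y hy =>
    ((hsmooth i).contDiffAt (isOpen_compl_singleton.mem_nhds hy)).continuousAt
  have hVpos : ∀ x, x ≠ 0 → 0 < V x := fun x hx => by
    rw [hVdef]; exact homNorm_pos hP hQ hx
  have hV : IsCommonLyapunov f V :=
    { cont := by rw [hVdef]; exact continuous_homNorm hP hQ
      zero := by rw [hVdef]; exact homNorm_zero _ _
      pos := hVpos
      radial := by rw [hVdef]; exact tendsto_homNorm_cocompact hP hQ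
      smooth := fun x hx => by
        rw [hVdef]; exact (contDiffAt_homNorm hP hQ hx).contDiffWithinAt
      decay := fun i x hx => (hdec i x hx).trans_lt
        (mul_neg_of_neg_of_pos (neg_neg_of_pos hρ) (Real.rpow_pos_of_pos (hVpos x hx) _)) }
  have hdil : IsLinearDilation (dil G) := isLinearDilation_dil hP hQ
  have hhom : ∀ i, IsHomogeneousField (dil G) μ (f i) := fun i => by
    rw [hf']; exact isHomogeneousField_homField hP hQ (hcomm i).1 (hC i)
  have hequil : ∀ i, 0 ∈ filippov (f i) 0 := fun i =>
    zero_mem_filippov_of_odd fun x => by rw [hf']; exact homField_neg hP hQ x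
  refine ⟨⟨hdil, fun x hx => ?_⟩, hV, hdec, fun σ _ t₀ _ x hx => ?_, fun i x hx => ?_, hhom,
    isHomogeneousSwitched hdil hhom hV hsmooth, fun hμ => ?_, fun _ hμ => ?_, fun hμ => ?_,
    fun hμ => ?_⟩
  · simp only [wnorm_eq_one_iff]
    exact existsUnique_quad_dil hP hQ hx
  · refine (ae_restrict_iff' measurableSet_Ici).2 ?_
    filter_upwards [hx.ae_hasDerivAt hcont] with t ht h0 hne
    exact ⟨_, (hV.hasFDerivAt hne).comp_hasDerivAt t (ht h0 hne), hdec _ _ hne⟩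
  · have h1 := norm_le_gainBound hX (K i) (quad_dil_log_homNorm hP hQ hx)
    have h2 : 0 ≤ V x ^ (1 + μ) := Real.rpow_nonneg (hV.nonneg x) _
    rw [hu, feedback, ← hVdef]
    rw [← hVdef] at h1
    refine (norm_add_le _ _).trans (add_le_add le_rfl ?_)
    rw [norm_smul, Real.norm_of_nonneg h2, mul_comm]
    gcongr
  · refine forwardComplete hV hsmooth (fun c => ?_) hequil
    choose M hM using fun i => exists_norm_homField_le (A₀ := A₀ i) (C := B i * K i) hP hQ hμ c
    refine ⟨∑ i, M i, fun i x hx => ?_⟩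
    rw [hf']
    refine (hM i x (by rwa [← hVdef])).trans ?_
    exact_mod_cast Finset.single_le_sum (f := M) (fun _ _ => zero_le) (Finset.mem_univ i)
  · exact ⟨uniformlyFiniteTimeStable hV hcont hdec hρ hμ, fun σ _ t₀ _ x hx t ht =>
      hx.eq_zero_of_neg hV hcont hdec hρ hμ ht⟩
  · obtain ⟨a, ha, b, hb, hle, hge⟩ :=
      exists_homNorm_equiv_norm hP hQ (by rw [hG, hμ, zero_smul, add_zero])
    exact ⟨uniformlyExponentiallyStable hV hcont hdec hρ hμ ha hb (by rwa [hVdef])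
      (by rwa [hVdef]), fun σ _ t₀ _ x hx t ht => hx.le_exp_of_eq_zero hV hcont hdec hμ ht⟩
  · exact ⟨uniformlyNearlyFixedTimeStable hV hcont hdec hρ hμ, fun σ _ t₀ _ x hx r hr t ht =>
      hx.le_of_pos hV hcont hdec hρ hμ hr ht⟩
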